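/- Let $\mathbf T=\mathbf R/2\pi\mathbf Z$, equipped with the normalized measure $dx/2\pi$. For $f\in L^2(\mathbf T;\mathbf C)$ write $\hat f(n)=\frac1{2\pi}\int_{\mathbf T}f(x)e^{-inx}\,dx$ and $\|\Lambda^s f\|_{L^2}^2=\sum_{n\in\mathbf Z}|n|^{2s}|\hat f(n)|^2$, where $\Lambda=(-\Delta)^{1/2}$; let $f^{(k)}$ be the weak derivative of order $k$, with the convention $\|f^{(k)}\|_{L^2}=\infty$ if $f$ has no weak derivative of order $k$ in $L^2$; and let $(-\Delta)^\gamma$ be the Fourier multiplier with symbol $|n|^{2\gamma}$. Let $\nu>0$, $\alpha\in\mathbf R$, $\gamma\ge 1$, $T>0$, $u_0\in L^2(\mathbf T;\mathbf C)$, and let the complex-valued function $u\in L^2([0,T]\times\mathbf T)$ be a weak solution on $[0,T]$ of $$u_t-6uu_x+\nu(-\Delta)^\gamma u+\alpha u_{xxx}=0,\qquad u(\cdot,0)=u_0,$$ that is, for every smooth $\varphi:\mathbf R\times\mathbf T\to\mathbf C$ that vanishes for all $t\ge\tau$, for some $\tau<T$, $$\int_0^T\!\!\int_{\mathbf T}\left(u\,\varphi_t-3u^2\varphi_x-\nu\,u\,(-\Delta)^\gamma\varphi+\alpha\,u\,\varphi_{xxx}\right)dx\,dt+\int_{\mathbf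 T}u_0\,\varphi(\cdot,0)\,dx=0.$$ Suppose that $u\in L^\infty([0,T];L^2)\cap L^2([0,T];\mathring H^\gamma)$, namely $$M_0=\sup_{t\in[0,T]}\|u(\cdot,t)\|_{L^2}^2+\nu\int_0^T\|\Lambda^\gamma u(\cdot,t)\|_{L^2}^2\,dt<\infty$$ (here and below $\sup$ over $t$ is the essential supremum, as in $L^\infty([0,T];L^2)$). Then, for every integer $k>0$: 1. if $u_0\in H^k(\mathbf T)$, then $$M_k=\sup_{t\in[0,T]}\|u^{(k)}(\cdot,t)\|_{L^2}^2+\nu\int_0^T\|\Lambda^{k+\gamma}u(\cdot,t)\|_{L^2}^2\,dt<\infty;$$ 2. without any further assumption on $u_0$, for every $0<\delta<T$, $$\sup_{t\in[\delta,T]}\|u^{(k)}(\cdot,t)\|_{L^2}^2+\nu\int_\delta^T\|\Lambda^{k+\gamma}u(\cdot,t)\|_{L^2}^2\,dt<\infty.$$ -/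

import Mathlib

open MeasureTheory
open scoped ENNReal ContDiff

noncomputable section

namespace FracKdVB

/-- The one-torus `ℝ / 2πℤ`. -/
abbrev Torus : Type := AddCircle (2 * Real.pi)

instance factTwoPiPos : Fact (0 < 2 * Real.pi) := ⟨Real.two_pi_pos⟩

/-- The normalized Haar measure on the torus: `dx / 2π`. With it
`‖f‖²_{L²} = ∑ₙ |f̂(n)|²`, where `f̂(n)` is Mathlib's `fourierCoeff f n`. -/
abbrev μT : Measure Torus := AddCircle.haarAddCircle

/-- Smooth functions on the torus (smooth periodic functions on the line). -/
def SmoothOnTorus (ψ : Torus → ℂ) : Prop :=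
  ContDiff ℝ ∞ (fun y : ℝ => ψ (y : Torus))

/-- The classical derivative of order `k` of a function on the torus. -/
def torusDeriv (k : ℕ) (ψ : Torus → ℂ) (x : Torus) : ℂ :=
  iteratedDeriv k (fun h : ℝ => ψ (x + (h : Torus))) 0

/-- The fractional Laplacian `(-Δ)^γ`, the Fourier multiplier with symbol `|n|^{2γ}`
(it is applied to smooth functions, whose Fourier series converge absolutely). -/
def fracLaplacian (γ : ℝ) (ψ : Torus → ℂ) (x : Torus) : ℂ :=
  ∑' n : ℤ, ((|(n : ℝ)| ^ (2 * γ) : ℝ) : ℂ) * fourierCoeff ψ n * fourier n x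

/-- `g` is the weak derivative of order `k` of the integrable function `f` on the torus. -/
def IsWeakDeriv (k : ℕ) (f g : Torus → ℂ) : Prop :=
  Integrable f μT ∧ Integrable g μT ∧
    ∀ ψ : Torus → ℂ, SmoothOnTorus ψ →
      ∫ x, f x * torusDeriv k ψ x ∂μT = (-1) ^ k * ∫ x, g x * ψ x ∂μT

/-- `‖f^{(k)}‖²_{L²}` for the weak derivative `f^{(k)}`, with the value `∞` if there is no
weak derivative of order `k` in `L²`. (The weak derivative is unique almost everywhere, so that
the infimum runs over at most one value.) -/
def derivNormSq (k : ℕ) (f : Torus → ℂ) : ℝ≥0∞ :=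
  ⨅ (g : Torus → ℂ) (_ : MemLp g 2 μT) (_ : IsWeakDeriv k f g), eLpNorm g 2 μT ^ 2

/-- `‖Λ^s f‖²_{L²} = ∑ₙ |n|^{2s} |f̂(n)|²`, the square of the homogeneous Sobolev norm of
order `s`; here `Λ = (-Δ)^{1/2}`. -/
def lambdaNormSq (s : ℝ) (f : Torus → ℂ) : ℝ≥0∞ :=
  ∑' n : ℤ, ENNReal.ofReal (|(n : ℝ)| ^ (2 * s)) * ‖fourierCoeff f n‖ₑ ^ 2

/-- Test functions: smooth on `ℝ × 𝕋` and zero from some time before `T` on. They need not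
vanish at time `0`. -/
structure IsTestFunction (T : ℝ) (φ : ℝ → Torus → ℂ) : Prop where
  smooth : ContDiff ℝ ∞ (fun p : ℝ × ℝ => φ p.1 (p.2 : Torus))
  vanishes : ∃ τ < T, ∀ t, τ ≤ t → ∀ x, φ t x = 0

/-- `u` is a weak solution on the time interval `[0, T]` of
`u_t - 6 u u_x + ν (-Δ)^γ u + α u_xxx = 0` with initial datum `u₀`: it is square integrable on
`[0, T] × 𝕋`, and the equation, with `6 u u_x = 3 (u²)_x`, holds after multiplication by any
test function and integration by parts. -/
structure IsWeakSolution (ν α γ T : ℝ) (u₀ : Torus → ℂ) (u : ℝ → Torus → ℂ) : Prop where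
  memLp_initial : MemLp u₀ 2 μT
  memLp : MemLp (Function.uncurry u) 2 ((volume.restrict (Set.Icc 0 T)).prod μT)
  weak_form : ∀ φ : ℝ → Torus → ℂ, IsTestFunction T φ →
    (∫ t in Set.Icc 0 T, ∫ x,
        (u t x * deriv (fun s => φ s x) t
          - 3 * u t x ^ 2 * torusDeriv 1 (φ t) x
          - (ν : ℂ) * u t x * fracLaplacian γ (φ t) x
          + (α : ℂ) * u t x * torusDeriv 3 (φ t) x) ∂μT)
      + ∫ x, u₀ x * φ 0 x ∂μT = 0

/-- `sup_{t ∈ [a, b]} ‖u(t)‖²_{L²} + ν ∫_a^b ‖Λ^γ u(t)‖²_{L²} dt`, where the supremum is that of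
the space `L^∞([a, b]; L²)`. -/
def baseEnergy (ν γ a b : ℝ) (u : ℝ → Torus → ℂ) : ℝ≥0∞ :=
  essSup (fun t => eLpNorm (u t) 2 μT ^ 2) (volume.restrict (Set.Icc a b))
    + ENNReal.ofReal ν * ∫⁻ t in Set.Icc a b, lambdaNormSq γ (u t)

/-- `sup_{t ∈ [a, b]} ‖u^{(k)}(t)‖²_{L²} + ν ∫_a^b ‖Λ^{k+γ} u(t)‖²_{L²} dt`, where the supremum
is that of the space `L^∞([a, b]; L²)`. -/
def higherEnergy (ν γ a b : ℝ) (k : ℕ) (u : ℝ → Torus → ℂ) : ℝ≥0∞ :=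
  essSup (fun t => derivNormSq k (u t)) (volume.restrict (Set.Icc a b))
    + ENNReal.ofReal ν * ∫⁻ t in Set.Icc a b, lambdaNormSq (k + γ) (u t)

end FracKdVB

end

/-! Everything happens on the Fourier side. Testing the equation against `η(t) e^{-inx}`, with the
integrating factor put into `η`, gives Duhamel's formula for each coefficient: `a_n' = -l_n a_n + 3
i n b_n`, where `b` belongs to `u²` and `Re l_n = ν|n|^{2γ}`. The dispersive term is imaginary in
the symbol and drops out of all absolute values.

Linear estimate: each mode satisfies `sup |a|² + Re l ∫|a|² ≲ |c|² + (Re l)⁻¹ 9n² ∫|b|²`. As `γ ≥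
1`, the factor `n²/|n|^{2γ}` is at most one, so dissipation pays for the derivative in the
nonlinearity: if the datum is in `H^s` and `u² ∈ L²H^s`, then `u ∈ L^∞H^s ∩ L²H^{s+γ}`
(`isRegular_of_forcing`).

Nonlinear estimate: `‖u²‖_{H^σ} ≲ ‖u‖_{H^{3/4}} ‖u‖_{H^σ}` because `3/4 > 1/2`
(`weightedSum_conv_le`). For `σ = s + 1/4`, interpolation bounds the square of the right side by
`‖u‖²_{H^1}‖u‖²_{H^s} + ‖u‖²_{L²}‖u‖²_{H^{s+1}}` (`weightedSum_mul_weightedSum_le`), integrable in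
time once `u` is regular at levels `0` and `s`. Hence a quarter derivative is gained
(`isRegular_add_quarter`), and `4k` gains reach `H^k`.

For smoothing, `u(t) ∈ H^{s+1}` for almost every `t`, and Duhamel's formula restarts at almost every
`t`; each gain starts from such a time (`isRegular_of_restart`). No cancellation in the nonlinearity
is used, so `u` may be complex. -/

namespace FracKdVB

/-! ### Frequency weights and Cauchy–Schwarz. -/

/-- The inhomogeneous frequency weight `max 1 |n|`. -/
noncomputable def weight (n : ℤ) : ℝ≥0∞ := ENNReal.ofReal (max 1 |(n : ℝ)|)

/-- The weighted square sum `∑ₙ max(1, |n|)^p xₙ²`. -/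
noncomputable def weightedSum (p : ℝ) (x : ℤ → ℝ≥0∞) : ℝ≥0∞ := ∑' n, weight n ^ p * x n ^ 2

lemma one_le_weight (n : ℤ) : 1 ≤ weight n := by
  unfold weight; rw [ENNReal.one_le_ofReal]; exact le_max_left _ _

lemma weight_ne_zero (n : ℤ) : weight n ≠ 0 := (zero_lt_one.trans_le (one_le_weight n)).ne'

lemma weight_ne_top (n : ℤ) : weight n ≠ ⊤ := ENNReal.ofReal_ne_top

lemma weight_rpow_add (n : ℤ) (p q : ℝ) : weight n ^ (p + q) = weight n ^ p * weight n ^ q :=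
  ENNReal.rpow_add p q (weight_ne_zero n) (weight_ne_top n)

lemma weight_rpow_mono (n : ℤ) {p q : ℝ} (h : p ≤ q) : weight n ^ p ≤ weight n ^ q :=
  ENNReal.rpow_le_rpow_of_exponent_le (one_le_weight n) h

lemma weight_rpow_sq (n : ℤ) (p : ℝ) : (weight n ^ p) ^ 2 = weight n ^ (2 * p) := by
  rw [two_mul, weight_rpow_add, sq]

lemma weight_add_le (m n : ℤ) : weight (m + n) ≤ weight m + weight n := by
  unfold weight
  rw [← ENNReal.ofReal_add (by positivity) (by positivity)]
  apply ENNReal.ofReal_le_ofReal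
  push_cast
  have h1 := le_max_left 1 |(m : ℝ)|
  have h2 := le_max_right 1 |(m : ℝ)|
  have h3 := le_max_left 1 |(n : ℝ)|
  have h4 := le_max_right 1 |(n : ℝ)|
  apply max_le
  · linarith
  · linarith [abs_add_le (m : ℝ) n]

lemma rpow_add_le_two_rpow_mul {σ : ℝ} (hσ : 0 ≤ σ) (x y : ℝ≥0∞) :
    (x + y) ^ σ ≤ 2 ^ σ * (x ^ σ + y ^ σ) := by
  have h : ∀ z : ℝ≥0∞, x + y ≤ 2 * z → z ^ σ ≤ x ^ σ + y ^ σ →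
      (x + y) ^ σ ≤ 2 ^ σ * (x ^ σ + y ^ σ) := by
    intro z h1 h2
    calc (x + y) ^ σ ≤ (2 * z) ^ σ := ENNReal.rpow_le_rpow h1 hσ
      _ = 2 ^ σ * z ^ σ := ENNReal.mul_rpow_of_nonneg _ _ hσ
      _ ≤ _ := by gcongr
  rcases le_total x y with hxy | hxy
  · exact h y (by rw [two_mul]; gcongr) le_add_self
  · exact h x (by rw [two_mul]; gcongr) le_self_add

lemma weight_rpow_add_le {σ : ℝ} (hσ : 0 ≤ σ) (m n : ℤ) :
    weight (m + n) ^ σ ≤ 2 ^ σ * (weight m ^ σ + weight n ^ σ) :=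
  (ENNReal.rpow_le_rpow (weight_add_le m n) hσ).trans (rpow_add_le_two_rpow_mul hσ _ _)

/-- Applied with `p = 3/2`, this is the embedding of `H^{3/4}` into absolutely convergent Fourier
series. -/
lemma tsum_weight_rpow_neg_lt_top {p : ℝ} (hp : 1 < p) : ∑' n : ℤ, weight n ^ (-p) < ⊤ := by
  have h1 : ∀ n : ℤ, weight n ^ (-p) ≤
      (if n = 0 then 1 else 0) + ENNReal.ofReal (|(n : ℝ)| ^ (-p)) := by
    intro n
    by_cases hn : n = 0
    · subst hn
      simp [weight]
    · have hn' : (1 : ℝ) ≤ |(n : ℝ)| := by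
        exact_mod_cast Int.one_le_abs hn
      rw [if_neg hn, zero_add, weight, max_eq_right hn',
        ENNReal.ofReal_rpow_of_pos (by linarith)]
  refine (ENNReal.tsum_le_tsum h1).trans_lt ?_
  rw [ENNReal.tsum_add, tsum_ite_eq]
  refine ENNReal.add_lt_top.2 ⟨ENNReal.one_lt_top, ?_⟩
  rw [← ENNReal.ofReal_tsum_of_nonneg (fun n => by positivity) (Real.summable_abs_int_rpow hp)]
  exact ENNReal.ofReal_lt_top

/-- Cauchy–Schwarz for the Lebesgue integral, in squared form. -/
lemma sq_lintegral_mul_le {X : Type*} [MeasurableSpace X] {μ : Measure X} {f g : X → ℝ≥0∞}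
    (hf : AEMeasurable f μ) (hg : AEMeasurable g μ) :
    (∫⁻ x, f x * g x ∂μ) ^ 2 ≤ (∫⁻ x, f x ^ 2 ∂μ) * ∫⁻ x, g x ^ 2 ∂μ := by
  have h := ENNReal.lintegral_mul_le_Lp_mul_Lq μ Real.HolderConjugate.two_two hf hg
  have h2 := pow_le_pow_left' h 2
  refine h2.trans (le_of_eq ?_)
  rw [mul_pow]
  simp only [← ENNReal.rpow_natCast, ← ENNReal.rpow_mul]
  norm_num

/-- Cauchy–Schwarz for sums, in squared form. -/
lemma sq_tsum_mul_le {ι : Type*} [Countable ι] (f g : ι → ℝ≥0∞) :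
    (∑' i, f i * g i) ^ 2 ≤ (∑' i, f i ^ 2) * ∑' i, g i ^ 2 := by
  let _ : MeasurableSpace ι := ⊤
  have := sq_lintegral_mul_le (μ := Measure.count) (f := f) (g := g)
    measurable_from_top.aemeasurable measurable_from_top.aemeasurable
  simpa [lintegral_count] using this

lemma sq_add_le (x y : ℝ≥0∞) : (x + y) ^ 2 ≤ 2 * x ^ 2 + 2 * y ^ 2 := by
  have h := ENNReal.rpow_add_le_mul_rpow_add_rpow x y (p := 2) (by norm_num)
  norm_num at h
  rwa [mul_add] at h

/-! ### Product and interpolation estimates in Sobolev spaces. -/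

/-- Bound for one of the two pieces of the convolution of a sequence with itself. -/
lemma tsum_sq_conv_le (σ : ℝ) (x : ℤ → ℝ≥0∞) :
    ∑' n, (∑' j, weight j ^ σ * x j * x (n - j)) ^ 2
      ≤ (∑' n, weight n ^ (-(3 / 2) : ℝ)) * (weightedSum (3 / 2) x * weightedSum (2 * σ) x) := by
  have h1 : ∀ n, (∑' j, weight j ^ σ * x j * x (n - j)) ^ 2 ≤
      (∑' n, weight n ^ (-(3 / 2) : ℝ)) *
        ∑' j, (weight j ^ (2 * σ) * x j ^ 2) * (weight (n - j) ^ (3 / 2 : ℝ) * x (n - j) ^ 2) := by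
    intro n
    -- Inserting `w^{-3/4} w^{3/4}` at frequency `n - j` before Cauchy–Schwarz leaves the summable
    -- weight `w^{-3/2}`.
    calc (∑' j, weight j ^ σ * x j * x (n - j)) ^ 2
        = (∑' j, weight (n - j) ^ (-(3 / 4) : ℝ) *
            (weight j ^ σ * x j * (weight (n - j) ^ (3 / 4 : ℝ) * x (n - j)))) ^ 2 := by
          congr 1
          refine tsum_congr fun j => ?_
          have : weight (n - j) ^ (-(3 / 4) : ℝ) * weight (n - j) ^ (3 / 4 : ℝ) = 1 := by
            rw [← weight_rpow_add]; norm_num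
          calc _ = 1 * (weight j ^ σ * x j * x (n - j)) := (one_mul _).symm
            _ = _ := by rw [← this]; ring
      _ ≤ _ := sq_tsum_mul_le _ _
      _ = _ := by
          congr 1
          · rw [← (Equiv.subLeft n).tsum_eq]
            refine tsum_congr fun j => ?_
            rw [weight_rpow_sq]
            simp only [Equiv.subLeft_apply]
            norm_num
          · refine tsum_congr fun j => ?_
            rw [mul_pow, mul_pow, mul_pow, weight_rpow_sq, weight_rpow_sq]
            norm_num
  refine (ENNReal.tsum_le_tsum h1).trans ?_
  rw [ENNReal.tsum_mul_left, ENNReal.tsum_comm]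
  gcongr
  refine le_of_eq ?_
  calc _ = ∑' j, (weight j ^ (2 * σ) * x j ^ 2) * weightedSum (3 / 2) x := by
        refine tsum_congr fun j => ?_
        rw [ENNReal.tsum_mul_left, weightedSum,
          ← (Equiv.subRight j).tsum_eq (fun n => weight n ^ (3 / 2 : ℝ) * x n ^ 2)]
        simp
    _ = _ := by rw [ENNReal.tsum_mul_right, mul_comm]; rfl

/-- A square in a Sobolev space, on the Fourier side. -/
lemma weightedSum_conv_le {σ : ℝ} (hσ : 0 ≤ σ) {x y : ℤ → ℝ≥0∞}
    (hy : ∀ n, y n ≤ ∑' j, x j * x (n - j)) :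
    weightedSum (2 * σ) y ≤ (2 * 2 ^ σ) ^ 2 * (∑' n, weight n ^ (-(3 / 2) : ℝ)) *
      (weightedSum (3 / 2) x * weightedSum (2 * σ) x) := by
  -- The weight at `n = j + (n - j)` splits between the two factors; the reflection `j ↦ n - j`
  -- identifies the two pieces, whence the extra factor 2.
  have h1 : ∀ n, weight n ^ σ * y n ≤
      2 * 2 ^ σ * ∑' j, weight j ^ σ * x j * x (n - j) := by
    intro n
    have hsymm : ∑' j, weight (n - j) ^ σ * x (n - j) * x j
        = ∑' j, weight j ^ σ * x j * x (n - j) := by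
      rw [← (Equiv.subLeft n).tsum_eq]
      simp
    calc weight n ^ σ * y n ≤ weight n ^ σ * ∑' j, x j * x (n - j) := by gcongr; exact hy n
      _ = ∑' j, weight n ^ σ * (x j * x (n - j)) := ENNReal.tsum_mul_left.symm
      _ ≤ ∑' j, 2 ^ σ * (weight j ^ σ * x j * x (n - j) + weight (n - j) ^ σ * x (n - j) * x j) := by
          refine ENNReal.tsum_le_tsum fun j => ?_
          have h := weight_rpow_add_le hσ j (n - j)
          rw [add_sub_cancel] at h
          calc _ ≤ 2 ^ σ * (weight j ^ σ + weight (n - j) ^ σ) * (x j * x (n - j)) := by gcongr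
            _ = _ := by ring
      _ = _ := by
          rw [ENNReal.tsum_mul_left, ENNReal.tsum_add, hsymm]; ring
  calc weightedSum (2 * σ) y = ∑' n, (weight n ^ σ * y n) ^ 2 := by
        refine tsum_congr fun n => ?_
        rw [mul_pow, weight_rpow_sq]
    _ ≤ ∑' n, (2 * 2 ^ σ) ^ 2 * (∑' j, weight j ^ σ * x j * x (n - j)) ^ 2 := by
        refine ENNReal.tsum_le_tsum fun n => ?_
        rw [← mul_pow]
        exact pow_le_pow_left' (h1 n) 2
    _ = (2 * 2 ^ σ) ^ 2 * ∑' n, (∑' j, weight j ^ σ * x j * x (n - j)) ^ 2 := ENNReal.tsum_mul_left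
    _ ≤ _ := by
        rw [mul_assoc]
        gcongr
        exact tsum_sq_conv_le σ x

/-- Interpolation of products of Sobolev norms. -/
lemma weightedSum_mul_weightedSum_le (p : ℝ) (x : ℤ → ℝ≥0∞) :
    weightedSum (3 / 2) x * weightedSum (p + 1 / 2) x
      ≤ weightedSum 2 x * weightedSum p x + weightedSum 0 x * weightedSum (p + 2) x := by
  -- The exponents add up to 2, so the larger of the two weights can replace both.
  have key : ∀ j l, weight j ^ (3 / 2 : ℝ) * weight l ^ (1 / 2 : ℝ) ≤
      weight j ^ (2 : ℝ) + weight l ^ (2 : ℝ) := by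
    intro j l
    rcases le_total (weight j) (weight l) with h | h
    · calc _ ≤ weight l ^ (3 / 2 : ℝ) * weight l ^ (1 / 2 : ℝ) := by gcongr
        _ = weight l ^ (2 : ℝ) := by rw [← weight_rpow_add]; norm_num
        _ ≤ _ := le_add_self
    · calc _ ≤ weight j ^ (3 / 2 : ℝ) * weight j ^ (1 / 2 : ℝ) := by gcongr
        _ = weight j ^ (2 : ℝ) := by rw [← weight_rpow_add]; norm_num
        _ ≤ _ := le_self_add
  unfold weightedSum
  simp_rw [← ENNReal.tsum_mul_right, ← ENNReal.tsum_mul_left, ← ENNReal.tsum_add]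
  refine ENNReal.tsum_le_tsum fun j => ENNReal.tsum_le_tsum fun l => ?_
  rw [weight_rpow_add, weight_rpow_add, ENNReal.rpow_zero]
  calc _ = weight j ^ (3 / 2 : ℝ) * weight l ^ (1 / 2 : ℝ) * (weight l ^ p * x j ^ 2 * x l ^ 2) := by
        ring
    _ ≤ (weight j ^ (2 : ℝ) + weight l ^ (2 : ℝ)) * (weight l ^ p * x j ^ 2 * x l ^ 2) := by
        gcongr; exact key j l
    _ = _ := by ring

/-! ### The damped linear equation for a single mode. -/

lemma lintegral_Ici_exp_neg_le {μ : ℝ} (hμ : 0 < μ) (s : ℝ) :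
    ∫⁻ t in Set.Ici s, ENNReal.ofReal (Real.exp (-μ * (t - s))) ≤ ENNReal.ofReal μ⁻¹ := by
  have hint : IntegrableOn (fun t => Real.exp (-μ * (t - s))) (Set.Ioi s) := by
    refine IntegrableOn.congr_fun
      ((integrableOn_exp_mul_Ioi (neg_lt_zero.2 hμ) s).const_mul (Real.exp (μ * s)))
      (fun t _ => ?_) measurableSet_Ioi
    simp only [← Real.exp_add]; ring_nf
  rw [setLIntegral_congr Ioi_ae_eq_Ici.symm,
    ← ofReal_integral_eq_lintegral_ofReal hint (Filter.Eventually.of_forall fun t => by positivity)]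
  apply ENNReal.ofReal_le_ofReal
  have : ∀ t, Real.exp (-μ * (t - s)) = Real.exp (μ * s) * Real.exp (-μ * t) := fun t => by
    rw [← Real.exp_add]; ring_nf
  simp_rw [this]
  rw [integral_const_mul, integral_exp_mul_Ioi (neg_lt_zero.2 hμ), div_neg, neg_div, neg_neg,
    mul_div_assoc', ← Real.exp_add]
  simp

lemma lintegral_Iic_exp_neg_le {μ : ℝ} (hμ : 0 < μ) (t : ℝ) :
    ∫⁻ s in Set.Iic t, ENNReal.ofReal (Real.exp (-μ * (t - s))) ≤ ENNReal.ofReal μ⁻¹ := by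
  have hint : IntegrableOn (fun s => Real.exp (-μ * (t - s))) (Set.Iic t) := by
    refine IntegrableOn.congr_fun
      ((integrableOn_exp_mul_Iic hμ t).const_mul (Real.exp (-(μ * t))))
      (fun s _ => ?_) measurableSet_Iic
    simp only [← Real.exp_add]; ring_nf
  rw [← ofReal_integral_eq_lintegral_ofReal hint
    (Filter.Eventually.of_forall fun t => by positivity)]
  apply ENNReal.ofReal_le_ofReal
  have : ∀ s, Real.exp (-μ * (t - s)) = Real.exp (-(μ * t)) * Real.exp (μ * s) := fun s => by
    rw [← Real.exp_add]; ring_nf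
  simp_rw [this]
  rw [integral_const_mul, integral_exp_mul_Iic hμ, mul_div_assoc', ← Real.exp_add]
  simp

/-- The kernel `e^{-μ(t-s)}` for `s ≤ t`, and zero otherwise. -/
noncomputable def decayKernel (μ t s : ℝ) : ℝ≥0∞ :=
  (Set.Iic t).indicator (fun s => ENNReal.ofReal (Real.exp (-μ * (t - s)))) s

lemma measurable_decayKernel (μ : ℝ) : Measurable (Function.uncurry (decayKernel μ)) := by
  have : Function.uncurry (decayKernel μ) = Set.indicator {p : ℝ × ℝ | p.2 ≤ p.1}
      (fun p => ENNReal.ofReal (Real.exp (-μ * (p.1 - p.2)))) := by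
    ext p; simp [Function.uncurry, decayKernel, Set.indicator]
  rw [this]
  refine Measurable.indicator (by fun_prop) (measurableSet_le measurable_snd measurable_fst)

lemma measurable_decayKernel_right (μ t : ℝ) : Measurable (decayKernel μ t) :=
  (measurable_decayKernel μ).comp measurable_prodMk_left

lemma decayKernel_le_one {μ : ℝ} (hμ : 0 < μ) (t s : ℝ) : decayKernel μ t s ≤ 1 := by
  unfold decayKernel
  refine Set.indicator_apply_le' (fun h => ?_) (fun _ => zero_le)
  rw [ENNReal.ofReal_le_one, Real.exp_le_one_iff]
  have : s ≤ t := h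
  nlinarith

lemma decayKernel_sq (μ t s : ℝ) : decayKernel (μ / 2) t s ^ 2 = decayKernel μ t s := by
  unfold decayKernel
  by_cases h : s ∈ Set.Iic t
  · rw [Set.indicator_of_mem h, Set.indicator_of_mem h, ← ENNReal.ofReal_pow (by positivity),
      ← Real.exp_nat_mul]
    congr 2; push_cast; ring
  · simp [Set.indicator_of_notMem h]

lemma lintegral_decayKernel_left_le {μ : ℝ} (hμ : 0 < μ) (s : ℝ) (S : Set ℝ) :
    ∫⁻ t in S, decayKernel μ t s ≤ ENNReal.ofReal μ⁻¹ := by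
  refine le_trans (setLIntegral_le_lintegral _ _) (le_trans (le_of_eq ?_)
    (lintegral_Ici_exp_neg_le hμ s))
  rw [← lintegral_indicator measurableSet_Ici]
  refine lintegral_congr fun t => ?_
  simp [decayKernel, Set.indicator]

lemma lintegral_decayKernel_right_le {μ : ℝ} (hμ : 0 < μ) (t : ℝ) (S : Set ℝ) :
    ∫⁻ s in S, decayKernel μ t s ≤ ENNReal.ofReal μ⁻¹ := by
  refine le_trans (setLIntegral_le_lintegral _ _) (le_trans (le_of_eq ?_)
    (lintegral_Iic_exp_neg_le hμ t))
  rw [← lintegral_indicator measurableSet_Iic]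
  rfl

/-- Half of Schur's test: the kernel is the square of the one with rate `μ / 2`, and Cauchy–Schwarz
puts one root on `g` and integrates the other to at most `1/μ`. -/
lemma sq_lintegral_decayKernel_mul_le {μ : ℝ} (hμ : 0 < μ) (t : ℝ) {S : Set ℝ} {g : ℝ → ℝ≥0∞}
    (hg : AEMeasurable g (volume.restrict S)) :
    (∫⁻ s in S, decayKernel μ t s * g s) ^ 2
      ≤ ENNReal.ofReal μ⁻¹ * ∫⁻ s in S, decayKernel μ t s * g s ^ 2 := by
  have hm := measurable_decayKernel_right (μ / 2) t
  calc (∫⁻ s in S, decayKernel μ t s * g s) ^ 2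
      = (∫⁻ s in S, decayKernel (μ / 2) t s * (decayKernel (μ / 2) t s * g s)) ^ 2 := by
        congr 1
        refine lintegral_congr fun s => ?_
        rw [← decayKernel_sq, sq, mul_assoc]
    _ ≤ (∫⁻ s in S, decayKernel (μ / 2) t s ^ 2) *
          ∫⁻ s in S, (decayKernel (μ / 2) t s * g s) ^ 2 :=
        sq_lintegral_mul_le hm.aemeasurable (hm.aemeasurable.mul hg)
    _ ≤ _ := by
        simp_rw [mul_pow, decayKernel_sq]
        gcongr
        exact lintegral_decayKernel_right_le hμ t S

/-- `a` is the solution on `[t₀, T]` of the linear equation `a' = -λ a + g` with `a(t₀) = c`,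
given by Duhamel's formula for almost every time. -/
def IsDuhamel (t₀ T : ℝ) (l c : ℂ) (g a : ℝ → ℂ) : Prop :=
  ∀ᵐ t ∂(volume.restrict (Set.Icc t₀ T)),
    a t = Complex.exp (-l * (t - t₀)) * c + ∫ s in t₀..t, Complex.exp (-l * (t - s)) * g s

lemma enorm_exp_neg (l : ℂ) (r : ℝ) :
    ‖Complex.exp (-l * r)‖ₑ = ENNReal.ofReal (Real.exp (-l.re * r)) := by
  rw [← ofReal_norm, Complex.norm_exp]; simp

lemma IsDuhamel.enorm_le {t₀ T : ℝ} {l c : ℂ} {g a : ℝ → ℂ} (h : IsDuhamel t₀ T l c g a) :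
    ∀ᵐ t ∂(volume.restrict (Set.Icc t₀ T)), ‖a t‖ₑ ≤ decayKernel l.re t t₀ * ‖c‖ₑ +
      ∫⁻ s in Set.Icc t₀ T, decayKernel l.re t s * ‖g s‖ₑ := by
  filter_upwards [h, ae_restrict_mem measurableSet_Icc] with t ht htI
  rw [ht]
  refine (enorm_add_le _ _).trans (add_le_add ?_ ?_)
  · rw [enorm_mul]
    have h1 := enorm_exp_neg l (t - t₀)
    push_cast at h1
    rw [h1, decayKernel, Set.indicator_of_mem (by exact htI.1)]
  · rw [intervalIntegral.integral_of_le htI.1]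
    refine (enorm_integral_le_lintegral_enorm _).trans ?_
    calc _ = ∫⁻ s in Set.Ioc t₀ t, decayKernel l.re t s * ‖g s‖ₑ := by
          refine setLIntegral_congr_fun measurableSet_Ioc fun s hs => ?_
          have h1 := enorm_exp_neg l (t - s)
          push_cast at h1
          simp only [enorm_mul]
          rw [h1, decayKernel, Set.indicator_of_mem (by exact hs.2)]
      _ ≤ _ := lintegral_mono_set ((Set.Ioc_subset_Icc_self).trans (Set.Icc_subset_Icc_right htI.2))

/-- Common source of the two energy bounds. The kernel is kept: bounding it by 1 gives the supremum,
integrating it in `t` gives the dissipation. -/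
lemma IsDuhamel.sq_enorm_le {t₀ T : ℝ} {l c : ℂ} {g a : ℝ → ℂ} (h : IsDuhamel t₀ T l c g a)
    (hl : 0 < l.re) (hg : AEMeasurable g (volume.restrict (Set.Icc t₀ T))) :
    ∀ᵐ t ∂(volume.restrict (Set.Icc t₀ T)), ‖a t‖ₑ ^ 2 ≤ 2 * (decayKernel l.re t t₀ * ‖c‖ₑ ^ 2) +
      2 * (ENNReal.ofReal l.re⁻¹ *
        ∫⁻ s in Set.Icc t₀ T, decayKernel l.re t s * ‖g s‖ₑ ^ 2) := by
  filter_upwards [h.enorm_le] with t ht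
  refine (pow_le_pow_left' ht 2).trans ((sq_add_le _ _).trans ?_)
  gcongr
  · rw [mul_pow]
    gcongr
    rw [sq]
    exact mul_le_of_le_one_left' (decayKernel_le_one hl _ _)
  · exact sq_lintegral_decayKernel_mul_le hl t hg.enorm

/-- The pointwise in time bound of the energy estimate for one Fourier mode. -/
lemma IsDuhamel.ae_sq_enorm_le {t₀ T : ℝ} {l c : ℂ} {g a : ℝ → ℂ} (h : IsDuhamel t₀ T l c g a)
    (hl : 0 < l.re) (hg : AEMeasurable g (volume.restrict (Set.Icc t₀ T))) :
    ∀ᵐ t ∂(volume.restrict (Set.Icc t₀ T)), ‖a t‖ₑ ^ 2 ≤ 2 * (‖c‖ₑ ^ 2 +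
      ENNReal.ofReal l.re⁻¹ * ∫⁻ s in Set.Icc t₀ T, ‖g s‖ₑ ^ 2) := by
  filter_upwards [h.sq_enorm_le hl hg] with t ht
  refine ht.trans ?_
  rw [mul_add]
  gcongr
  · exact mul_le_of_le_one_left' (decayKernel_le_one hl _ _)
  · exact mul_le_of_le_one_left' (decayKernel_le_one hl _ _)

/-- The dissipation bound of the energy estimate for one Fourier mode. -/
lemma IsDuhamel.lintegral_sq_enorm_le {t₀ T : ℝ} {l c : ℂ} {g a : ℝ → ℂ}
    (h : IsDuhamel t₀ T l c g a) (hl : 0 < l.re)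
    (hg : AEMeasurable g (volume.restrict (Set.Icc t₀ T))) :
    ENNReal.ofReal l.re * ∫⁻ t in Set.Icc t₀ T, ‖a t‖ₑ ^ 2 ≤ 2 * (‖c‖ₑ ^ 2 +
      ENNReal.ofReal l.re⁻¹ * ∫⁻ s in Set.Icc t₀ T, ‖g s‖ₑ ^ 2) := by
  have hK : ∀ s, Measurable fun t => decayKernel l.re t s := fun s =>
    (measurable_decayKernel l.re).comp measurable_prodMk_right
  have hcancel : ENNReal.ofReal l.re * ENNReal.ofReal l.re⁻¹ = 1 := by
    rw [← ENNReal.ofReal_mul hl.le, mul_inv_cancel₀ hl.ne', ENNReal.ofReal_one]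
  -- The other half of Schur's test: by Tonelli, the kernel is integrated in `t` first.
  have hswap : ∫⁻ t in Set.Icc t₀ T, ∫⁻ s in Set.Icc t₀ T, decayKernel l.re t s * ‖g s‖ₑ ^ 2
      ≤ ENNReal.ofReal l.re⁻¹ * ∫⁻ s in Set.Icc t₀ T, ‖g s‖ₑ ^ 2 := by
    rw [lintegral_lintegral_swap]
    · rw [← lintegral_const_mul'' _ (hg.enorm.pow_const 2)]
      refine lintegral_mono fun s => ?_
      rw [lintegral_mul_const _ (hK s)]
      gcongr
      exact lintegral_decayKernel_left_le hl s _
    · exact (measurable_decayKernel l.re).aemeasurable.mul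
        ((hg.enorm.pow_const 2).comp_snd)
  calc ENNReal.ofReal l.re * ∫⁻ t in Set.Icc t₀ T, ‖a t‖ₑ ^ 2
      ≤ ENNReal.ofReal l.re * ∫⁻ t in Set.Icc t₀ T, (2 * (decayKernel l.re t t₀ * ‖c‖ₑ ^ 2) +
      2 * (ENNReal.ofReal l.re⁻¹ *
        ∫⁻ s in Set.Icc t₀ T, decayKernel l.re t s * ‖g s‖ₑ ^ 2)) := by
        exact mul_le_mul_right (lintegral_mono_ae (h.sq_enorm_le hl hg)) _
    _ = ENNReal.ofReal l.re * (2 * ((∫⁻ t in Set.Icc t₀ T, decayKernel l.re t t₀) * ‖c‖ₑ ^ 2) +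
          2 * (ENNReal.ofReal l.re⁻¹ * ∫⁻ t in Set.Icc t₀ T,
            ∫⁻ s in Set.Icc t₀ T, decayKernel l.re t s * ‖g s‖ₑ ^ 2)) := by
        rw [lintegral_add_left (((hK t₀).mul_const _).const_mul _), lintegral_const_mul' _ _ (by simp),
          lintegral_mul_const _ (hK t₀), lintegral_const_mul' _ _ (by simp),
          lintegral_const_mul' _ _ ENNReal.ofReal_ne_top]
    _ ≤ ENNReal.ofReal l.re * (2 * (ENNReal.ofReal l.re⁻¹ * ‖c‖ₑ ^ 2) +
          2 * (ENNReal.ofReal l.re⁻¹ * (ENNReal.ofReal l.re⁻¹ *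
            ∫⁻ s in Set.Icc t₀ T, ‖g s‖ₑ ^ 2))) := by
        gcongr
        exact lintegral_decayKernel_left_le hl t₀ _
    _ = (ENNReal.ofReal l.re * ENNReal.ofReal l.re⁻¹) * (2 * (‖c‖ₑ ^ 2 +
      ENNReal.ofReal l.re⁻¹ * ∫⁻ s in Set.Icc t₀ T, ‖g s‖ₑ ^ 2)) := by ring
    _ = _ := by rw [hcancel, one_mul]

/-! ### The system of Fourier modes and its energy estimate. -/

/-- The symbol of the linear part `ν (-Δ)^γ + α ∂ₓ³`. -/
noncomputable def linearSymbol (ν α γ : ℝ) (n : ℤ) : ℂ :=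
  (ν * |(n : ℝ)| ^ (2 * γ) : ℝ) - Complex.I * (α * (n : ℝ) ^ 3 : ℝ)

lemma linearSymbol_re (ν α γ : ℝ) (n : ℤ) :
    (linearSymbol ν α γ n).re = ν * |(n : ℝ)| ^ (2 * γ) := by
  simp [linearSymbol, -Complex.ofReal_mul, -Complex.ofReal_pow]

lemma linearSymbol_zero (ν α : ℝ) {γ : ℝ} (hγ : 1 ≤ γ) : linearSymbol ν α γ 0 = 0 := by
  have : 2 * γ ≠ 0 := by positivity
  simp [linearSymbol, Real.zero_rpow this]

/-- The weighted square sum `∑ₙ max(1, |n|)^p |n|^{2γ} xₙ²`. -/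
noncomputable def dissipationSum (γ p : ℝ) (x : ℤ → ℝ≥0∞) : ℝ≥0∞ :=
  ∑' n : ℤ, weight n ^ p * (ENNReal.ofReal (|(n : ℝ)| ^ (2 * γ)) * x n ^ 2)

lemma weight_sq_le {γ : ℝ} (hγ : 1 ≤ γ) (n : ℤ) :
    weight n ^ (2 : ℝ) ≤ 1 + ENNReal.ofReal (|(n : ℝ)| ^ (2 * γ)) := by
  have hpos : (0 : ℝ) < max 1 |(n : ℝ)| := by positivity
  rw [weight, ENNReal.ofReal_rpow_of_pos hpos, ← ENNReal.ofReal_one,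
    ← ENNReal.ofReal_add zero_le_one (by positivity)]
  apply ENNReal.ofReal_le_ofReal
  by_cases hn : n = 0
  · subst hn
    simp only [Int.cast_zero, abs_zero]
    have : (0 : ℝ) ≤ 0 ^ (2 * γ) := by positivity
    simpa using this
  · have hn' : (1 : ℝ) ≤ |(n : ℝ)| := by exact_mod_cast Int.one_le_abs hn
    rw [max_eq_right hn']
    have := Real.rpow_le_rpow_of_exponent_le hn' (show (2 : ℝ) ≤ 2 * γ by linarith)
    linarith

lemma weightedSum_add_two_le {γ : ℝ} (hγ : 1 ≤ γ) (p : ℝ) (x : ℤ → ℝ≥0∞) :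
    weightedSum (p + 2) x ≤ weightedSum p x + dissipationSum γ p x := by
  unfold weightedSum dissipationSum
  rw [← ENNReal.tsum_add]
  refine ENNReal.tsum_le_tsum fun n => ?_
  rw [weight_rpow_add]
  calc _ = weight n ^ p * (weight n ^ (2 : ℝ) * x n ^ 2) := by ring
    _ ≤ weight n ^ p * ((1 + ENNReal.ofReal (|(n : ℝ)| ^ (2 * γ))) * x n ^ 2) := by
        gcongr; exact weight_sq_le hγ n
    _ = _ := by ring

lemma aemeasurable_weightedSum {S : Set ℝ} {a : ℝ → ℤ → ℂ}
    (ha : ∀ n, AEMeasurable (fun t => a t n) (volume.restrict S)) (p : ℝ) :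
    AEMeasurable (fun t => weightedSum p fun n => ‖a t n‖ₑ) (volume.restrict S) :=
  AEMeasurable.tsum fun n => ((ha n).enorm.pow_const 2).const_mul _

/-- `a ∈ L^∞([t₀, T]; H^s) ∩ L²([t₀, T]; H^{s+γ})`, for a family of Fourier coefficients. -/
structure IsRegular (γ t₀ T s : ℝ) (a : ℝ → ℤ → ℂ) : Prop where
  bounded : ∃ C : ℝ≥0∞, C < ⊤ ∧ ∀ᵐ t ∂(volume.restrict (Set.Icc t₀ T)),
    weightedSum (2 * s) (fun n => ‖a t n‖ₑ) ≤ C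
  dissipation : ∫⁻ t in Set.Icc t₀ T, dissipationSum γ (2 * s) (fun n => ‖a t n‖ₑ) < ⊤

lemma IsRegular.mono {γ t₀ t₁ T s : ℝ} {a : ℝ → ℤ → ℂ} (h : IsRegular γ t₀ T s a)
    (ht : t₀ ≤ t₁) : IsRegular γ t₁ T s a := by
  have hsub : Set.Icc t₁ T ⊆ Set.Icc t₀ T := Set.Icc_subset_Icc_left ht
  obtain ⟨C, hC, hC'⟩ := h.bounded
  exact ⟨⟨C, hC, ae_restrict_of_ae_restrict_of_subset hsub hC'⟩,
    (lintegral_mono_set hsub).trans_lt h.dissipation⟩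

/-- Regularity at level `s` yields `L²H^{s+1}`: dissipation controls the high frequencies since `γ ≥
1`, and the uniform bound on a finite interval controls the zero mode. -/
lemma IsRegular.lintegral_weightedSum_lt_top {γ t₀ T s : ℝ} {a : ℝ → ℤ → ℂ} (hγ : 1 ≤ γ)
    (h : IsRegular γ t₀ T s a)
    (ha : ∀ n, AEMeasurable (fun t => a t n) (volume.restrict (Set.Icc t₀ T))) :
    ∫⁻ t in Set.Icc t₀ T, weightedSum (2 * s + 2) (fun n => ‖a t n‖ₑ) < ⊤ := by
  obtain ⟨C, hC, hC'⟩ := h.bounded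
  refine (lintegral_mono fun t => weightedSum_add_two_le hγ (2 * s) _).trans_lt ?_
  rw [lintegral_add_left' (aemeasurable_weightedSum ha _)]
  refine ENNReal.add_lt_top.2 ⟨(lintegral_mono_ae hC').trans_lt ?_, h.dissipation⟩
  simp [ENNReal.mul_lt_top_iff, hC]

/-- The Fourier coefficients `a`, `b` of `u`, `u²` for a solution of the equation on `[t₀, T]`
with Fourier coefficients `c` at time `t₀`. -/
structure IsModalSolution (ν α γ t₀ T : ℝ) (c : ℤ → ℂ) (a b : ℝ → ℤ → ℂ) : Prop where
  aemeasurable_left : ∀ n, AEMeasurable (fun t => a t n) (volume.restrict (Set.Icc t₀ T))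
  aemeasurable_right : ∀ n, AEMeasurable (fun t => b t n) (volume.restrict (Set.Icc t₀ T))
  enorm_le_conv : ∀ᵐ t ∂(volume.restrict (Set.Icc t₀ T)), ∀ n,
    ‖b t n‖ₑ ≤ ∑' j, ‖a t j‖ₑ * ‖a t (n - j)‖ₑ
  duhamel : ∀ n : ℤ, IsDuhamel t₀ T (linearSymbol ν α γ n) (c n)
    (fun t => 3 * Complex.I * n * b t n) (fun t => a t n)

namespace IsModalSolution

variable {ν α γ t₀ T : ℝ} {c : ℤ → ℂ} {a b : ℝ → ℤ → ℂ}

/-- Here dissipation absorbs the derivative of `3(u²)_x`: `9n² / (ν|n|^{2γ}) ≤ 9/ν` for `|n| ≥ 1`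
and `γ ≥ 1`. -/
lemma inv_re_mul_lintegral_le (hν : 0 < ν) (hγ : 1 ≤ γ) {n : ℤ} (hn : n ≠ 0) :
    ENNReal.ofReal (linearSymbol ν α γ n).re⁻¹ *
        ∫⁻ s in Set.Icc t₀ T, ‖3 * Complex.I * n * b s n‖ₑ ^ 2
      ≤ ENNReal.ofReal (9 / ν) * ∫⁻ s in Set.Icc t₀ T, ‖b s n‖ₑ ^ 2 := by
  have hn' : (1 : ℝ) ≤ |(n : ℝ)| := by exact_mod_cast Int.one_le_abs hn
  have h1 : ∀ s, ‖3 * Complex.I * n * b s n‖ₑ ^ 2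
      = ENNReal.ofReal (9 * |(n : ℝ)| ^ 2) * ‖b s n‖ₑ ^ 2 := by
    intro s
    rw [enorm_mul, mul_pow]
    congr 1
    rw [← ofReal_norm, ← ENNReal.ofReal_pow (norm_nonneg _)]
    congr 1
    simp [mul_pow]
    norm_num
  simp_rw [h1]
  rw [lintegral_const_mul' _ _ ENNReal.ofReal_ne_top, ← mul_assoc, linearSymbol_re,
    ← ENNReal.ofReal_mul (by positivity)]
  gcongr
  have h2 : |(n : ℝ)| ^ 2 ≤ |(n : ℝ)| ^ (2 * γ) := by
    rw [← Real.rpow_natCast]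
    exact Real.rpow_le_rpow_of_exponent_le hn' (by push_cast; linarith)
  have h3 : 0 < |(n : ℝ)| ^ (2 * γ) := by positivity
  rw [inv_mul_le_iff₀ (by positivity)]
  calc 9 * |(n : ℝ)| ^ 2 ≤ 9 * |(n : ℝ)| ^ (2 * γ) := by gcongr
    _ = _ := by field_simp

lemma re_linearSymbol_pos (hν : 0 < ν) {n : ℤ} (hn : n ≠ 0) :
    0 < (linearSymbol ν α γ n).re := by
  have hn' : (1 : ℝ) ≤ |(n : ℝ)| := by exact_mod_cast Int.one_le_abs hn
  rw [linearSymbol_re]; positivity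

lemma ae_sq_enorm_le (h : IsModalSolution ν α γ t₀ T c a b) (hν : 0 < ν) (hγ : 1 ≤ γ) (n : ℤ) :
    ∀ᵐ t ∂(volume.restrict (Set.Icc t₀ T)), ‖a t n‖ₑ ^ 2 ≤ 2 * (‖c n‖ₑ ^ 2 +
      ENNReal.ofReal (9 / ν) * ∫⁻ s in Set.Icc t₀ T, ‖b s n‖ₑ ^ 2) := by
  by_cases hn : n = 0
  · subst hn
    -- The mean is conserved: at `n = 0` both symbol and forcing vanish, and Duhamel's formula reads
    -- `a = c`.
    filter_upwards [h.duhamel 0] with t ht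
    rw [linearSymbol_zero ν α hγ] at ht
    simp only [Int.cast_zero, mul_zero, zero_mul, neg_zero, Complex.exp_zero, one_mul,
      intervalIntegral.integral_zero, add_zero] at ht
    rw [ht, mul_add]
    refine le_add_right ?_
    rw [two_mul]
    exact le_self_add
  · filter_upwards [(h.duhamel n).ae_sq_enorm_le (re_linearSymbol_pos hν hn)
      ((h.aemeasurable_right n).const_mul _)] with t ht
    refine ht.trans ?_
    exact mul_le_mul_right (add_le_add le_rfl (inv_re_mul_lintegral_le hν hγ hn)) _

lemma lintegral_sq_enorm_le (h : IsModalSolution ν α γ t₀ T c a b) (hν : 0 < ν) (hγ : 1 ≤ γ)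
    (n : ℤ) : ENNReal.ofReal ν *
      (ENNReal.ofReal (|(n : ℝ)| ^ (2 * γ)) * ∫⁻ t in Set.Icc t₀ T, ‖a t n‖ₑ ^ 2) ≤
      2 * (‖c n‖ₑ ^ 2 + ENNReal.ofReal (9 / ν) * ∫⁻ s in Set.Icc t₀ T, ‖b s n‖ₑ ^ 2) := by
  by_cases hn : n = 0
  · have : 2 * γ ≠ 0 := by positivity
    simp [hn, Real.zero_rpow this]
  · rw [← mul_assoc, ← ENNReal.ofReal_mul hν.le, ← linearSymbol_re ν α]
    refine ((h.duhamel n).lintegral_sq_enorm_le (re_linearSymbol_pos hν hn)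
      ((h.aemeasurable_right n).const_mul _)).trans ?_
    exact mul_le_mul_right (add_le_add le_rfl (inv_re_mul_lintegral_le hν hγ hn)) _

lemma tsum_weight_eq (h : IsModalSolution ν α γ t₀ T c a b) (p : ℝ) :
    ∑' n, weight n ^ p * (2 * (‖c n‖ₑ ^ 2 +
        ENNReal.ofReal (9 / ν) * ∫⁻ s in Set.Icc t₀ T, ‖b s n‖ₑ ^ 2))
      = 2 * (weightedSum p (fun n => ‖c n‖ₑ) + ENNReal.ofReal (9 / ν) *
        ∫⁻ s in Set.Icc t₀ T, weightedSum p fun n => ‖b s n‖ₑ) := by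
  unfold weightedSum
  rw [lintegral_tsum fun n => ((h.aemeasurable_right n).enorm.pow_const 2).const_mul _,
    ← ENNReal.tsum_mul_left, ← ENNReal.tsum_add, ← ENNReal.tsum_mul_left]
  refine tsum_congr fun n => ?_
  rw [lintegral_const_mul'' _ ((h.aemeasurable_right n).enorm.pow_const 2)]
  ring

/-- The linear energy estimate in Sobolev spaces. -/
lemma isRegular_of_forcing (h : IsModalSolution ν α γ t₀ T c a b) (hν : 0 < ν) (hγ : 1 ≤ γ)
    {s : ℝ} (hc : weightedSum (2 * s) (fun n => ‖c n‖ₑ) < ⊤)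
    (hb : ∫⁻ t in Set.Icc t₀ T, weightedSum (2 * s) (fun n => ‖b t n‖ₑ) < ⊤) :
    IsRegular γ t₀ T s a := by
  have hfin : 2 * (weightedSum (2 * s) (fun n => ‖c n‖ₑ) + ENNReal.ofReal (9 / ν) *
        ∫⁻ t in Set.Icc t₀ T, weightedSum (2 * s) fun n => ‖b t n‖ₑ) < ⊤ :=
    ENNReal.mul_lt_top (by simp)
      (ENNReal.add_lt_top.2 ⟨hc, ENNReal.mul_lt_top ENNReal.ofReal_lt_top hb⟩)
  refine ⟨⟨_, hfin, ?_⟩, ?_⟩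
  · filter_upwards [ae_all_iff.2 (h.ae_sq_enorm_le hν hγ)] with t ht
    rw [← h.tsum_weight_eq]
    exact ENNReal.tsum_le_tsum fun n => mul_le_mul_right (ht n) _
  · unfold dissipationSum
    rw [lintegral_tsum fun n =>
      (((h.aemeasurable_left n).enorm.pow_const 2).const_mul _).const_mul _]
    have hle : ENNReal.ofReal ν * ∑' n : ℤ, ∫⁻ t in Set.Icc t₀ T, weight n ^ (2 * s) *
        (ENNReal.ofReal (|(n : ℝ)| ^ (2 * γ)) * ‖a t n‖ₑ ^ 2) < ⊤ := by
      refine lt_of_le_of_lt ?_ hfin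
      rw [← h.tsum_weight_eq, ← ENNReal.tsum_mul_left]
      refine ENNReal.tsum_le_tsum fun n => ?_
      rw [lintegral_const_mul'' _ (((h.aemeasurable_left n).enorm.pow_const 2).const_mul _),
        lintegral_const_mul'' _ ((h.aemeasurable_left n).enorm.pow_const 2), mul_left_comm]
      exact mul_le_mul_right (h.lintegral_sq_enorm_le hν hγ n) _
    exact ENNReal.lt_top_of_mul_ne_top_right hle.ne (ENNReal.ofReal_pos.2 hν).ne'

/-- A gain of a quarter of a derivative. -/
lemma isRegular_add_quarter (h : IsModalSolution ν α γ t₀ T c a b) (hν : 0 < ν) (hγ : 1 ≤ γ)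
    {s : ℝ} (hs : 0 ≤ s) (h0 : IsRegular γ t₀ T 0 a) (hreg : IsRegular γ t₀ T s a)
    (hc : weightedSum (2 * (s + 1 / 4)) (fun n => ‖c n‖ₑ) < ⊤) :
    IsRegular γ t₀ T (s + 1 / 4) a := by
  refine h.isRegular_of_forcing hν hγ hc ?_
  obtain ⟨C₀, hC₀, hb₀⟩ := h0.bounded
  obtain ⟨C, hC, hb⟩ := hreg.bounded
  have hI₀ := h0.lintegral_weightedSum_lt_top hγ h.aemeasurable_left
  have hI := hreg.lintegral_weightedSum_lt_top hγ h.aemeasurable_left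
  rw [mul_zero] at hb₀
  rw [mul_zero, zero_add] at hI₀
  set K : ℝ≥0∞ := (2 * 2 ^ (s + 1 / 4)) ^ 2 * ∑' n, weight n ^ (-(3 / 2) : ℝ) with hK
  have hKfin : K < ⊤ := by
    refine ENNReal.mul_lt_top (ENNReal.pow_lt_top (ENNReal.mul_lt_top (by simp) ?_))
      (tsum_weight_rpow_neg_lt_top (by norm_num))
    exact ENNReal.rpow_lt_top_of_nonneg (by positivity) (by simp)
  -- In each interpolated product, one factor is bounded uniformly in time and the other is
  -- integrable in time.
  have hle : ∀ᵐ t ∂(volume.restrict (Set.Icc t₀ T)),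
      weightedSum (2 * (s + 1 / 4)) (fun n => ‖b t n‖ₑ) ≤
        K * (C * weightedSum 2 (fun n => ‖a t n‖ₑ) +
          C₀ * weightedSum (2 * s + 2) (fun n => ‖a t n‖ₑ)) := by
    filter_upwards [h.enorm_le_conv, hb₀, hb] with t h1 h2 h3
    refine (weightedSum_conv_le (by positivity) h1).trans ?_
    refine mul_le_mul_right ?_ _
    rw [show 2 * (s + 1 / 4) = 2 * s + 1 / 2 by ring]
    refine (weightedSum_mul_weightedSum_le (2 * s) _).trans ?_
    rw [mul_comm C]
    gcongr
  refine (lintegral_mono_ae hle).trans_lt ?_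
  rw [lintegral_const_mul' _ _ hKfin.ne,
    lintegral_add_left' ((aemeasurable_weightedSum h.aemeasurable_left _).const_mul _),
    lintegral_const_mul' _ _ hC.ne, lintegral_const_mul' _ _ hC₀.ne]
  exact ENNReal.mul_lt_top hKfin (ENNReal.add_lt_top.2
    ⟨ENNReal.mul_lt_top hC hI₀, ENNReal.mul_lt_top hC₀ hI⟩)

end IsModalSolution

/-! ### Iteration of the gain: propagation and smoothing. -/

lemma weightedSum_mono (x : ℤ → ℝ≥0∞) {p q : ℝ} (h : p ≤ q) :
    weightedSum p x ≤ weightedSum q x :=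
  ENNReal.tsum_le_tsum fun n => mul_le_mul_left (weight_rpow_mono n h) _

/-- Propagation of regularity from the initial time. -/
lemma IsModalSolution.isRegular_of_initial {ν α γ t₀ T : ℝ} {c : ℤ → ℂ} {a b : ℝ → ℤ → ℂ}
    (h : IsModalSolution ν α γ t₀ T c a b) (hν : 0 < ν) (hγ : 1 ≤ γ) {r : ℝ}
    (h0 : IsRegular γ t₀ T 0 a) (hc : weightedSum (2 * r) (fun n => ‖c n‖ₑ) < ⊤) (m : ℕ)
    (hm : (m / 4 : ℝ) ≤ r) : IsRegular γ t₀ T (m / 4) a := by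
  induction m with
  | zero => simpa using h0
  | succ m ih =>
    push_cast at hm ⊢
    have hm' : (m / 4 : ℝ) + 1 / 4 ≤ r := by linarith
    rw [add_div]
    refine h.isRegular_add_quarter hν hγ (by positivity) h0 (ih (by linarith)) ?_
    exact (weightedSum_mono _ (by linarith)).trans_lt hc

/-- Smoothing: if the equation can be restarted at almost every time, then the solution is
regular away from the initial time. -/
lemma isRegular_of_restart {ν α γ T : ℝ} {a b : ℝ → ℤ → ℂ} (hν : 0 < ν) (hγ : 1 ≤ γ)
    (h0 : IsRegular γ 0 T 0 a)
    (ha : ∀ n, AEMeasurable (fun t => a t n) (volume.restrict (Set.Icc 0 T)))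
    (hrestart : ∀ᵐ t₀ ∂(volume.restrict (Set.Icc 0 T)),
      IsModalSolution ν α γ t₀ T (a t₀) a b) (m : ℕ) :
    ∀ δ, 0 < δ → δ < T → IsRegular γ δ T (m / 4) a := by
  induction m with
  | zero =>
    intro δ hδ _
    simpa using h0.mono hδ.le
  | succ m ih =>
    intro δ hδ hδT
    have hsub : Set.Icc (δ / 2) T ⊆ Set.Icc 0 T := Set.Icc_subset_Icc_left (by linarith)
    have hreg := ih (δ / 2) (by linarith) (by linarith)
    have hfin := hreg.lintegral_weightedSum_lt_top hγ
      fun n => (ha n).mono_measure (Measure.restrict_mono hsub le_rfl)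
    have hae : ∀ᵐ t ∂(volume.restrict (Set.Icc (δ / 2) T)),
        weightedSum (2 * (m / 4) + 2) (fun n => ‖a t n‖ₑ) < ⊤ :=
      ae_lt_top' (aemeasurable_weightedSum
        (fun n => (ha n).mono_measure (Measure.restrict_mono hsub le_rfl)) _) hfin.ne
    have hsub' : Set.Icc (δ / 2) δ ⊆ Set.Icc (δ / 2) T := Set.Icc_subset_Icc_right hδT.le
    have hboth : ∀ᵐ t ∂(volume.restrict (Set.Icc (δ / 2) δ)),
        (weightedSum (2 * (m / 4) + 2) (fun n => ‖a t n‖ₑ) < ⊤ ∧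
          IsModalSolution ν α γ t T (a t) a b) ∧ t ∈ Set.Icc (δ / 2) δ :=
      ((ae_restrict_of_ae_restrict_of_subset hsub' hae).and
        (ae_restrict_of_ae_restrict_of_subset (hsub'.trans hsub) hrestart)).and
        (ae_restrict_mem measurableSet_Icc)
    -- `[δ/2, δ]` has positive measure, so it contains a time where `a t` lies in `H^{m/4+1}` and
    -- the equation restarts; only a quarter of that derivative is needed.
    have : NeZero (volume.restrict (Set.Icc (δ / 2) δ)) := by
      refine ⟨fun h => ?_⟩
      rw [Measure.restrict_eq_zero, Real.volume_Icc, ENNReal.ofReal_eq_zero] at h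
      linarith
    obtain ⟨t, ⟨ht1, ht2⟩, ht3⟩ := hboth.exists
    push_cast
    rw [add_div]
    refine (ht2.isRegular_add_quarter hν hγ (by positivity) (h0.mono (by linarith [ht3.1]))
      (hreg.mono ht3.1) ?_).mono ht3.2
    exact (weightedSum_mono _ (by linarith)).trans_lt ht1

/-! ### Fourier series on the torus: Parseval, convolution, Riesz–Fischer. -/

lemma norm_fourier_apply (n : ℤ) (x : Torus) : ‖(fourier n x : ℂ)‖ = 1 := by
  rw [fourier_apply, Circle.norm_coe]

lemma memLp_fourier_mul {f : Torus → ℂ} (hf : MemLp f 2 μT) (n : ℤ) :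
    MemLp (fun x => (fourier n x : ℂ) * f x) 2 μT := by
  refine hf.of_le ((map_continuous (fourier n)).aestronglyMeasurable.mul hf.1) ?_
  filter_upwards with x
  rw [norm_mul, norm_fourier_apply, one_mul]

lemma fourierCoeff_fourier_mul (f : Torus → ℂ) (m n : ℤ) :
    fourierCoeff (fun x => (fourier m x : ℂ) * f x) n = fourierCoeff f (n - m) := by
  unfold fourierCoeff
  congr 1
  ext x
  rw [smul_eq_mul, smul_eq_mul, ← mul_assoc, ← fourier_add, neg_sub, sub_eq_neg_add]

lemma fourierCoeff_conj (f : Torus → ℂ) (n : ℤ) :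
    fourierCoeff (fun x => (starRingEnd ℂ) (f x)) n = (starRingEnd ℂ) (fourierCoeff f (-n)) := by
  unfold fourierCoeff
  rw [← integral_conj]
  congr 1
  ext x
  rw [smul_eq_mul, smul_eq_mul, map_mul, ← fourier_neg, neg_neg]

lemma memLp_conj {f : Torus → ℂ} (hf : MemLp f 2 μT) :
    MemLp (fun x => (starRingEnd ℂ) (f x)) 2 μT :=
  hf.of_le (Complex.continuous_conj.comp_aestronglyMeasurable hf.1) (by simp)

/-- Parseval's identity in bilinear form. -/
lemma hasSum_fourierCoeff_mul {f g : Torus → ℂ} (hf : MemLp f 2 μT) (hg : MemLp g 2 μT) :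
    HasSum (fun j => fourierCoeff f j * fourierCoeff g (-j)) (∫ x, f x * g x ∂μT) := by
  have hg' := memLp_conj hg
  have h := (fourierBasis (T := 2 * Real.pi)).hasSum_inner_mul_inner (hg'.toLp _) (hf.toLp f)
  have h1 : ∀ j, inner ℂ (fourierBasis j) (hf.toLp f) = fourierCoeff f j := fun j => by
    rw [← HilbertBasis.repr_apply_apply, fourierBasis_repr, fourierCoeff_congr_ae hf.coeFn_toLp]
  have h2 : ∀ j, inner ℂ (hg'.toLp _) (fourierBasis j) = fourierCoeff g (-j) := fun j => by
    rw [← inner_conj_symm, ← HilbertBasis.repr_apply_apply, fourierBasis_repr,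
      fourierCoeff_congr_ae hg'.coeFn_toLp, fourierCoeff_conj, Complex.conj_conj]
  have h3 : inner ℂ (hg'.toLp _) (hf.toLp f) = ∫ x, f x * g x ∂μT := by
    rw [L2.inner_def]
    refine integral_congr_ae ?_
    filter_upwards [hf.coeFn_toLp, hg'.coeFn_toLp] with x hx1 hx2
    rw [hx1, hx2]
    simp
  rw [h3] at h
  refine h.congr_fun fun j => ?_
  rw [h1, h2, mul_comm]

/-- Bilinear Parseval for the pair `f`, `e^{-inx} f`; it needs only `f ∈ L²`, although `f²` is then
merely integrable. -/
lemma enorm_fourierCoeff_sq_le_conv {f : Torus → ℂ} (hf : MemLp f 2 μT) (n : ℤ) :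
    ‖fourierCoeff (fun x => f x ^ 2) n‖ₑ
      ≤ ∑' j, ‖fourierCoeff f j‖ₑ * ‖fourierCoeff f (n - j)‖ₑ := by
  have h := hasSum_fourierCoeff_mul hf (memLp_fourier_mul hf (-n))
  have h1 : fourierCoeff (fun x => f x ^ 2) n = ∫ x, f x * ((fourier (-n) x : ℂ) * f x) ∂μT := by
    unfold fourierCoeff
    congr 1; ext x
    rw [smul_eq_mul]; ring
  rw [h1, ← h.tsum_eq]
  refine enorm_tsum_le_tsum_enorm.trans (le_of_eq (tsum_congr fun j => ?_))
  rw [enorm_mul, fourierCoeff_fourier_mul]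
  congr 3
  ring

/-- Parseval's identity with values in `[0, ∞]`. -/
lemma tsum_enorm_fourierCoeff_sq {f : Torus → ℂ} (hf : MemLp f 2 μT) :
    ∑' n, ‖fourierCoeff f n‖ₑ ^ 2 = eLpNorm f 2 μT ^ 2 := by
  have h := hasSum_sq_fourierCoeff (hf.toLp f)
  simp_rw [fourierCoeff_congr_ae hf.coeFn_toLp] at h
  have h2 : ∫ x, ‖hf.toLp f x‖ ^ 2 ∂μT = ∫ x, ‖f x‖ ^ 2 ∂μT :=
    integral_congr_ae (by filter_upwards [hf.coeFn_toLp] with x hx; rw [hx])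
  rw [h2] at h
  have h3 : ∀ z : ℂ, ‖z‖ₑ ^ 2 = ENNReal.ofReal (‖z‖ ^ 2) := fun z => by
    rw [← ofReal_norm, ENNReal.ofReal_pow (norm_nonneg _)]
  have h4 := eLpNorm_nnreal_pow_eq_lintegral (μ := μT) (f := f) (p := 2) two_ne_zero
  norm_num at h4
  rw [h4]
  simp_rw [h3]
  rw [← ENNReal.ofReal_tsum_of_nonneg (fun n => by positivity) h.summable, h.tsum_eq,
    ofReal_integral_eq_lintegral_ofReal hf.integrable_norm_pow' (ae_of_all _ fun x => by positivity)]

/-- The Riesz–Fischer theorem on the torus. -/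
lemma exists_memLp_fourierCoeff_eq {c : ℤ → ℂ} (hc : ∑' n, ‖c n‖ₑ ^ 2 < ⊤) :
    ∃ g : Torus → ℂ, MemLp g 2 μT ∧ ∀ n, fourierCoeff g n = c n := by
  have hmem : Memℓp c 2 := by
    refine memℓp_gen ?_
    have h := ENNReal.summable_toReal hc.ne
    refine h.congr fun n => ?_
    simp
  refine ⟨fourierBasis.repr.symm ⟨c, hmem⟩, Lp.memLp _, fun n => ?_⟩
  rw [← fourierBasis_repr, LinearIsometryEquiv.apply_symm_apply]

/-! ### Classical and weak derivatives in terms of Fourier coefficients. -/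

lemma torusDeriv_coe (k : ℕ) (ψ : Torus → ℂ) (y : ℝ) :
    torusDeriv k ψ (y : Torus) = iteratedDeriv k (fun y : ℝ => ψ (y : Torus)) y := by
  have := iteratedDeriv_comp_const_add k (fun y : ℝ => ψ (y : Torus)) y
  unfold torusDeriv
  have h2 := congrFun this 0
  simp only [add_zero, AddCircle.coe_add] at h2
  exact h2

lemma torusDeriv_zero (ψ : Torus → ℂ) : torusDeriv 0 ψ = ψ := by
  ext x
  simp [torusDeriv]

lemma torusDeriv_succ (k : ℕ) (ψ : Torus → ℂ) :
    torusDeriv (k + 1) ψ = torusDeriv 1 (torusDeriv k ψ) := by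
  ext x
  induction x using QuotientAddGroup.induction_on with
  | H y =>
    rw [torusDeriv_coe, torusDeriv_coe, iteratedDeriv_succ, iteratedDeriv_one]
    congr 1
    ext z
    exact (torusDeriv_coe k ψ z).symm

lemma SmoothOnTorus.torusDeriv {ψ : Torus → ℂ} (h : SmoothOnTorus ψ) (k : ℕ) :
    SmoothOnTorus (torusDeriv k ψ) := by
  unfold SmoothOnTorus
  simp_rw [torusDeriv_coe]
  rw [iteratedDeriv_eq_iterate]
  exact ContDiff.iterate_deriv k h

lemma SmoothOnTorus.continuous {ψ : Torus → ℂ} (h : SmoothOnTorus ψ) : Continuous ψ :=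
  (QuotientAddGroup.isQuotientMap_mk _).continuous_iff.2 (ContDiff.continuous h)

lemma SmoothOnTorus.memLp {ψ : Torus → ℂ} (h : SmoothOnTorus ψ) : MemLp ψ 2 μT :=
  h.continuous.memLp_of_hasCompactSupport (HasCompactSupport.of_compactSpace _)

lemma SmoothOnTorus.hasDerivAt {ψ : Torus → ℂ} (h : SmoothOnTorus ψ) (y : ℝ) :
    HasDerivAt (fun y : ℝ => ψ (y : Torus)) (FracKdVB.torusDeriv 1 ψ (y : Torus)) y := by
  rw [torusDeriv_coe, iteratedDeriv_one]
  exact ((ContDiff.differentiable h (by simp)) y).hasDerivAt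

lemma hasDerivAt_fourier_torus (n : ℤ) (y : ℝ) :
    HasDerivAt (fun y : ℝ => (fourier n (y : Torus) : ℂ))
      (Complex.I * n * fourier n (y : Torus)) y := by
  convert hasDerivAt_fourier (2 * Real.pi) n y using 1
  have : (Real.pi : ℂ) ≠ 0 := by exact_mod_cast Real.pi_ne_zero
  push_cast
  field_simp

lemma smoothOnTorus_fourier (n : ℤ) : SmoothOnTorus (fun x => (fourier n x : ℂ)) := by
  unfold SmoothOnTorus
  simp_rw [fourier_coe_apply]
  have := Complex.ofRealCLM.contDiff (n := ∞)
  exact (((contDiff_const.mul this).div_const _)).cexp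

lemma torusDeriv_const_mul_fourier (k : ℕ) (c : ℂ) (n : ℤ) (x : Torus) :
    torusDeriv k (fun x => c * (fourier n x : ℂ)) x = (Complex.I * n) ^ k * (c * fourier n x) := by
  induction k generalizing x with
  | zero => simp [torusDeriv_zero]
  | succ k ih =>
    rw [torusDeriv_succ, funext ih]
    induction x using QuotientAddGroup.induction_on with
    | H y =>
      rw [torusDeriv_coe, iteratedDeriv_one]
      refine HasDerivAt.deriv ?_
      convert! ((hasDerivAt_fourier_torus n y).const_mul c).const_mul ((Complex.I * n) ^ k) using 1
      ring_nf

lemma torusDeriv_fourier (k : ℕ) (n : ℤ) (x : Torus) :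
    torusDeriv k (fun x => (fourier n x : ℂ)) x = (Complex.I * n) ^ k * fourier n x := by
  simpa using torusDeriv_const_mul_fourier k 1 n x

lemma fracLaplacian_const_mul_fourier (γ : ℝ) (c : ℂ) (n : ℤ) (x : Torus) :
    fracLaplacian γ (fun x => c * (fourier n x : ℂ)) x
      = ((|(n : ℝ)| ^ (2 * γ) : ℝ) : ℂ) * (c * fourier n x) := by
  unfold fracLaplacian
  rw [tsum_eq_single n]
  · rw [fourierCoeff.const_mul, fourierCoeff_fourier]
    simp [mul_assoc]
  · intro m hm
    rw [fourierCoeff.const_mul, fourierCoeff_fourier]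
    simp [hm]

lemma fourierCoeff_torusDeriv_one {ψ : Torus → ℂ} (h : SmoothOnTorus ψ) (n : ℤ) :
    fourierCoeff (torusDeriv 1 ψ) n = Complex.I * n * fourierCoeff ψ n := by
  rw [fourierCoeff_eq_intervalIntegral _ _ 0, fourierCoeff_eq_intervalIntegral _ _ 0]
  simp only [smul_eq_mul]
  have hc1 : Continuous fun y : ℝ => torusDeriv 1 ψ (y : Torus) :=
    (h.torusDeriv 1).continuous.comp (AddCircle.continuous_mk' _)
  have hc2 : Continuous fun y : ℝ => Complex.I * ((-n : ℤ) : ℂ) * (fourier (-n) (y : Torus) : ℂ) :=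
    continuous_const.mul ((map_continuous (fourier (-n))).comp (AddCircle.continuous_mk' _))
  rw [intervalIntegral.integral_mul_deriv_eq_deriv_mul
    (fun y _ => hasDerivAt_fourier_torus (-n) y) (fun y _ => h.hasDerivAt y)
    (hc2.intervalIntegrable _ _) (hc1.intervalIntegrable _ _)]
  -- The boundary terms of the integration by parts cancel by periodicity.
  have hper : (((0 : ℝ) + 2 * Real.pi : ℝ) : Torus) = ((0 : ℝ) : Torus) := by
    rw [zero_add, AddCircle.coe_period]; rfl
  rw [hper, sub_self, zero_sub, ← intervalIntegral.integral_neg]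
  rw [mul_smul_comm, ← intervalIntegral.integral_const_mul]
  congr 2
  ext y
  push_cast
  ring

lemma fourierCoeff_torusDeriv {ψ : Torus → ℂ} (h : SmoothOnTorus ψ) (k : ℕ) (n : ℤ) :
    fourierCoeff (torusDeriv k ψ) n = (Complex.I * n) ^ k * fourierCoeff ψ n := by
  induction k with
  | zero => simp [torusDeriv_zero]
  | succ k ih =>
    rw [torusDeriv_succ, fourierCoeff_torusDeriv_one (h.torusDeriv k), ih]
    ring

lemma isWeakDeriv_of_fourierCoeff {k : ℕ} {f g : Torus → ℂ} (hf : MemLp f 2 μT)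
    (hg : MemLp g 2 μT) (h : ∀ n, fourierCoeff g n = (Complex.I * n) ^ k * fourierCoeff f n) :
    IsWeakDeriv k f g := by
  refine ⟨hf.integrable (by norm_num), hg.integrable (by norm_num), fun ψ hψ => ?_⟩
  have h1 := hasSum_fourierCoeff_mul hf (hψ.torusDeriv k).memLp
  have h2 := (hasSum_fourierCoeff_mul hg hψ.memLp).mul_left ((-1) ^ k)
  refine h1.unique (h2.congr_fun fun j => ?_)
  rw [h, fourierCoeff_torusDeriv hψ]
  push_cast
  rw [mul_neg, neg_pow]
  ring

lemma IsWeakDeriv.fourierCoeff_eq {k : ℕ} {f g : Torus → ℂ} (h : IsWeakDeriv k f g) (n : ℤ) :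
    fourierCoeff g n = (Complex.I * n) ^ k * fourierCoeff f n := by
  have h1 := h.2.2 _ (smoothOnTorus_fourier (-n))
  simp_rw [torusDeriv_fourier] at h1
  have h2 : ∫ x, f x * ((Complex.I * ((-n : ℤ) : ℂ)) ^ k * (fourier (-n) x : ℂ)) ∂μT
      = (-1) ^ k * ((Complex.I * n) ^ k * fourierCoeff f n) := by
    rw [fourierCoeff, ← integral_const_mul, ← integral_const_mul]
    congr 1; ext x
    push_cast
    rw [mul_neg, neg_pow, smul_eq_mul]
    ring
  have h3 : ∫ x, g x * (fourier (-n) x : ℂ) ∂μT = fourierCoeff g n := by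
    unfold fourierCoeff
    congr 1; ext x
    rw [smul_eq_mul, mul_comm]
  rw [h2, h3] at h1
  exact (mul_left_cancel₀ (pow_ne_zero k (by norm_num)) h1).symm

lemma enorm_I_mul_pow_sq (k : ℕ) (n : ℤ) :
    ‖(Complex.I * n) ^ k‖ₑ ^ 2 = ENNReal.ofReal (|(n : ℝ)| ^ (2 * k)) := by
  rw [← ofReal_norm, ← ENNReal.ofReal_pow (norm_nonneg _)]
  congr 1
  simp [← pow_mul, mul_comm]

lemma ofReal_abs_pow_le_weight (k : ℕ) (n : ℤ) :
    ENNReal.ofReal (|(n : ℝ)| ^ (2 * k)) ≤ weight n ^ (2 * (k : ℝ)) := by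
  rw [ENNReal.ofReal_pow (abs_nonneg _), ← ENNReal.rpow_natCast]
  push_cast
  gcongr
  exact ENNReal.ofReal_le_ofReal (le_max_right _ _)

lemma weight_rpow_le (k : ℕ) (n : ℤ) :
    weight n ^ (2 * (k : ℝ)) ≤ 1 + ENNReal.ofReal (|(n : ℝ)| ^ (2 * k)) := by
  rcases le_total |(n : ℝ)| 1 with h | h
  · rw [weight, max_eq_left h]
    simp
  · rw [weight, max_eq_right h, ENNReal.ofReal_pow (abs_nonneg _), ← ENNReal.rpow_natCast]
    push_cast
    exact le_add_self

/-- A weak derivative is controlled by the Fourier coefficients. -/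
lemma derivNormSq_le_weightedSum (k : ℕ) {f : Torus → ℂ} (hf : MemLp f 2 μT) :
    derivNormSq k f ≤ weightedSum (2 * k) fun n => ‖fourierCoeff f n‖ₑ := by
  rcases eq_or_ne (weightedSum (2 * k) fun n => ‖fourierCoeff f n‖ₑ) ⊤ with h | h
  · rw [h]; exact le_top
  have hle : ∑' n : ℤ, ‖(Complex.I * n) ^ k * fourierCoeff f n‖ₑ ^ 2
      ≤ weightedSum (2 * k) fun n => ‖fourierCoeff f n‖ₑ := by
    refine ENNReal.tsum_le_tsum fun n => ?_
    rw [enorm_mul, mul_pow, enorm_I_mul_pow_sq]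
    gcongr
    exact ofReal_abs_pow_le_weight k n
  obtain ⟨g, hg, hgc⟩ := exists_memLp_fourierCoeff_eq (hle.trans_lt h.lt_top)
  have hweak := isWeakDeriv_of_fourierCoeff hf hg hgc
  refine (iInf₂_le_of_le g hg (iInf_le_of_le hweak le_rfl)).trans ?_
  rw [← tsum_enorm_fourierCoeff_sq hg]
  simpa only [hgc] using hle

/-- A weak derivative controls the Fourier coefficients. -/
lemma weightedSum_lt_top_of_derivNormSq {k : ℕ} {f : Torus → ℂ} (hf : MemLp f 2 μT)
    (h : derivNormSq k f < ⊤) : weightedSum (2 * k) (fun n => ‖fourierCoeff f n‖ₑ) < ⊤ := by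
  unfold derivNormSq at h
  simp only [iInf_lt_iff] at h
  obtain ⟨g, hg, hweak, -⟩ := h
  have hle : weightedSum (2 * k) (fun n => ‖fourierCoeff f n‖ₑ)
      ≤ eLpNorm f 2 μT ^ 2 + eLpNorm g 2 μT ^ 2 := by
    rw [← tsum_enorm_fourierCoeff_sq hf, ← tsum_enorm_fourierCoeff_sq hg, ← ENNReal.tsum_add]
    refine ENNReal.tsum_le_tsum fun n => ?_
    rw [hweak.fourierCoeff_eq, enorm_mul, mul_pow, enorm_I_mul_pow_sq]
    calc _ ≤ (1 + ENNReal.ofReal (|(n : ℝ)| ^ (2 * k))) * ‖fourierCoeff f n‖ₑ ^ 2 := by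
          gcongr; exact weight_rpow_le k n
      _ = _ := by ring
  exact hle.trans_lt (ENNReal.add_lt_top.2
    ⟨ENNReal.pow_lt_top hf.eLpNorm_lt_top, ENNReal.pow_lt_top hg.eLpNorm_lt_top⟩)

/-! ### Weak differential equations in time and Duhamel's formula. -/

lemma integral_primitive_mul_eq {T : ℝ} {ψ : ℝ → ℝ} {h : ℝ → ℂ}
    (hψ : Continuous ψ) (hh : IntegrableOn h (Set.Ioc 0 T)) :
    ∫ t in Set.Ioc 0 T, ((∫ s in T..t, ψ s : ℝ) : ℂ) * h t
      = - ∫ s in Set.Ioc 0 T, (ψ s : ℂ) * ∫ t in (0 : ℝ)..s, h t := by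
  have hψi : IntegrableOn (fun s => (ψ s : ℂ)) (Set.Ioc 0 T) :=
    ((Complex.continuous_ofReal.comp hψ).integrableOn_Icc).mono_set Set.Ioc_subset_Icc_self
  have hprod : Integrable (Function.uncurry fun t s : ℝ =>
      Set.indicator {p : ℝ × ℝ | p.1 < p.2} (fun p => h p.1 * (ψ p.2 : ℂ)) (t, s))
      ((volume.restrict (Set.Ioc 0 T)).prod (volume.restrict (Set.Ioc 0 T))) :=
    (Integrable.mul_prod hh hψi).indicator (measurableSet_lt measurable_fst measurable_snd)
  have h1 : ∀ t ∈ Set.Ioc 0 T, ((∫ s in T..t, ψ s : ℝ) : ℂ) * h t = -∫ s in Set.Ioc 0 T,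
      Set.indicator {p : ℝ × ℝ | p.1 < p.2} (fun p => h p.1 * (ψ p.2 : ℂ)) (t, s) := by
    intro t ht
    have e1 : ∀ s, Set.indicator {p : ℝ × ℝ | p.1 < p.2} (fun p => h p.1 * (ψ p.2 : ℂ)) (t, s)
        = (Set.Ioi t).indicator (fun s => h t * (ψ s : ℂ)) s := fun s => by
      simp [Set.indicator]
    simp_rw [e1]
    rw [setIntegral_indicator measurableSet_Ioi, integral_const_mul,
      intervalIntegral.integral_of_ge ht.2, Set.Ioc_inter_Ioi, max_eq_right ht.1.le,
      integral_complex_ofReal]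
    push_cast
    ring
  have h2 : ∀ s ∈ Set.Ioc 0 T, (ψ s : ℂ) * (∫ t in (0 : ℝ)..s, h t) = ∫ t in Set.Ioc 0 T,
      Set.indicator {p : ℝ × ℝ | p.1 < p.2} (fun p => h p.1 * (ψ p.2 : ℂ)) (t, s) := by
    intro s hs
    have e1 : ∀ t, Set.indicator {p : ℝ × ℝ | p.1 < p.2} (fun p => h p.1 * (ψ p.2 : ℂ)) (t, s)
        = (Set.Iio s).indicator (fun t => h t * (ψ s : ℂ)) t := fun t => by
      simp [Set.indicator]
    simp_rw [e1]
    have e2 : Set.Ioc 0 T ∩ Set.Iio s = Set.Ioo 0 s := by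
      ext t
      simp only [Set.mem_inter_iff, Set.mem_Ioc, Set.mem_Iio, Set.mem_Ioo]
      exact ⟨fun h => ⟨h.1.1, h.2⟩, fun h => ⟨⟨h.1, h.2.le.trans hs.2⟩, h.2⟩⟩
    rw [setIntegral_indicator measurableSet_Iio, e2, integral_mul_const,
      intervalIntegral.integral_of_le hs.1.le, integral_Ioc_eq_integral_Ioo, mul_comm]
  rw [setIntegral_congr_fun measurableSet_Ioc h1, setIntegral_congr_fun measurableSet_Ioc h2,
    integral_neg, integral_integral_swap hprod]

/-- Integrating from `T` makes the primitive vanish near `T`, so it is an admissible test function;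
its value at `0` need not vanish and brings in the initial datum. -/
lemma exists_smooth_primitive {T : ℝ} {ψ : ℝ → ℝ} (hψ : ContDiff ℝ ∞ ψ)
    (hc : HasCompactSupport ψ) (hs : tsupport ψ ⊆ Set.Ioo 0 T) :
    ContDiff ℝ ∞ (fun t => ∫ s in T..t, ψ s) ∧ (deriv fun t => ∫ s in T..t, ψ s) = ψ ∧
      ∃ τ < T, ∀ t, τ ≤ t → ∫ s in T..t, ψ s = 0 := by
  have hd : (deriv fun t => ∫ s in T..t, ψ s) = ψ := by
    ext t
    exact (hψ.continuous.integral_hasStrictDerivAt T t).hasDerivAt.deriv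
  refine ⟨contDiff_infty_iff_deriv.2 ⟨fun t =>
    (hψ.continuous.integral_hasStrictDerivAt T t).hasDerivAt.differentiableAt, by rwa [hd]⟩, hd, ?_⟩
  obtain ⟨τ, hτ, hzero⟩ : ∃ τ < T, ∀ s, τ < s → ψ s = 0 := by
    rcases (tsupport ψ).eq_empty_or_nonempty with he | hne
    · refine ⟨T - 1, by linarith, fun s _ => ?_⟩
      rw [tsupport_eq_empty_iff] at he
      simp [he]
    · obtain ⟨τ, hτ⟩ := IsCompact.exists_isGreatest hc hne
      refine ⟨τ, (hs hτ.1).2, fun s hs' => ?_⟩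
      by_contra hne'
      exact absurd (hτ.2 (subset_tsupport ψ hne')) (not_le.2 hs')
  refine ⟨τ, hτ, fun t ht => ?_⟩
  refine intervalIntegral.integral_zero_ae (ae_of_all _ fun s hs' => hzero s ?_)
  exact (le_min hτ.le ht).trans_lt hs'.1

/-- A weak solution of `f' = h`, `f(0) = c`, is almost everywhere given by integration. -/
lemma ae_eq_add_integral_of_weak {T : ℝ} (hT : 0 < T) {f h : ℝ → ℂ} {c : ℂ}
    (hf : IntegrableOn f (Set.Icc 0 T)) (hh : IntegrableOn h (Set.Icc 0 T))
    (H : ∀ θ : ℝ → ℝ, ContDiff ℝ ∞ θ → (∃ τ < T, ∀ t, τ ≤ t → θ t = 0) →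
      (∫ t in Set.Icc 0 T, (((deriv θ t : ℝ) : ℂ) * f t + (θ t : ℂ) * h t)) + θ 0 * c = 0) :
    ∀ᵐ t ∂(volume.restrict (Set.Icc 0 T)), f t = c + ∫ s in (0 : ℝ)..t, h s := by
  have hf' : IntegrableOn f (Set.Ioc 0 T) := hf.mono_set Set.Ioc_subset_Icc_self
  have hh' : IntegrableOn h (Set.Ioc 0 T) := hh.mono_set Set.Ioc_subset_Icc_self
  have hcont : ContinuousOn (fun t => ∫ s in (0 : ℝ)..t, h s) (Set.Icc 0 T) := by
    have := intervalIntegral.continuousOn_primitive_interval (f := h) (μ := volume)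
      (a := 0) (b := T) (by rwa [Set.uIcc_of_le hT.le])
    rwa [Set.uIcc_of_le hT.le] at this
  have hint : IntegrableOn (fun t => ∫ s in (0 : ℝ)..t, h s) (Set.Ioc 0 T) :=
    (hcont.integrableOn_Icc).mono_set Set.Ioc_subset_Icc_self
  have hci : IntegrableOn (fun _ : ℝ => c) (Set.Ioc 0 T) := by simp
  have hF : IntegrableOn (fun t => f t - (c + ∫ s in (0 : ℝ)..t, h s)) (Set.Ioc 0 T) :=
    hf'.sub (hci.add hint)
  have key := isOpen_Ioo.ae_eq_zero_of_integral_contDiff_smul_eq_zero (μ := volume)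
    (U := Set.Ioo 0 T) (f := fun t => f t - (c + ∫ s in (0 : ℝ)..t, h s))
    (hF.mono_set Set.Ioo_subset_Ioc_self).locallyIntegrableOn ?_
  · rw [← restrict_Ioo_eq_restrict_Icc, ae_restrict_iff' measurableSet_Ioo]
    filter_upwards [key] with t ht htI
    exact sub_eq_zero.1 (ht htI)
  · intro ψ hψ hc hs
    -- The weak equation is tested with the primitive of `ψ`; Fubini moves the primitive from `ψ`
    -- onto `h`, and `ψ` is left paired with `f - c - ∫ h`.
    obtain ⟨h1, h2, h3⟩ := exists_smooth_primitive hψ hc hs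
    have hw := H _ h1 h3
    rw [h2, integral_Icc_eq_integral_Ioc] at hw
    have hmul : ∀ {θ : ℝ → ℝ} {g : ℝ → ℂ}, Continuous θ → IntegrableOn g (Set.Ioc 0 T) →
        IntegrableOn (fun t => (θ t : ℂ) * g t) (Set.Ioc 0 T) := by
      intro θ g hθ hg
      rw [← integrableOn_Icc_iff_integrableOn_Ioc] at hg ⊢
      exact hg.continuousOn_mul (Complex.continuous_ofReal.comp hθ).continuousOn isCompact_Icc
    rw [integral_add (hmul hψ.continuous hf') (hmul h1.continuous hh'),
      integral_primitive_mul_eq hψ.continuous hh'] at hw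
    have h0 : ((∫ s in T..0, ψ s : ℝ) : ℂ) = - ∫ s in Set.Ioc 0 T, (ψ s : ℂ) := by
      rw [intervalIntegral.integral_of_ge hT.le, integral_complex_ofReal]
      push_cast; rfl
    rw [h0] at hw
    have hsupp : ∀ t ∉ Set.Ioc 0 T, ψ t • (f t - (c + ∫ s in (0 : ℝ)..t, h s)) = 0 := by
      intro t ht
      have : ψ t = 0 := by
        by_contra hne
        exact ht (Set.Ioo_subset_Ioc_self (hs (subset_tsupport ψ hne)))
      rw [this, zero_smul]
    rw [← setIntegral_eq_integral_of_forall_compl_eq_zero hsupp]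
    have hsplit : ∫ t in Set.Ioc 0 T, ψ t • (f t - (c + ∫ s in (0 : ℝ)..t, h s))
        = (∫ t in Set.Ioc 0 T, (ψ t : ℂ) * f t) - ((∫ t in Set.Ioc 0 T, (ψ t : ℂ) * c) +
          ∫ t in Set.Ioc 0 T, (ψ t : ℂ) * ∫ s in (0 : ℝ)..t, h s) := by
      have hadd : IntegrableOn (fun t => (ψ t : ℂ) * c + (ψ t : ℂ) * ∫ s in (0 : ℝ)..t, h s)
          (Set.Ioc 0 T) := (hmul hψ.continuous hci).add (hmul hψ.continuous hint)
      rw [← integral_add (hmul hψ.continuous hci) (hmul hψ.continuous hint),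
        ← integral_sub (hmul hψ.continuous hf') hadd]
      refine integral_congr_ae (ae_of_all _ fun t => ?_)
      simp only [Complex.real_smul]
      ring
    rw [hsplit, integral_mul_const]
    linear_combination hw

/-- Duhamel's formula from time `t₀` on, from the formula with initial time `0`. -/
lemma isDuhamel_of_integrating_factor {t₀ T : ℝ} {l c : ℂ} {g a : ℝ → ℂ} (ht₀ : t₀ ∈ Set.Icc 0 T)
    (hg : IntegrableOn (fun s : ℝ => Complex.exp (l * s) * g s) (Set.Icc 0 T)) {c₀ : ℂ}
    (h₀ : Complex.exp (l * t₀) * c = c₀ + ∫ s in (0 : ℝ)..t₀, Complex.exp (l * s) * g s)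
    (h : ∀ᵐ t : ℝ ∂(volume.restrict (Set.Icc 0 T)),
      Complex.exp (l * t) * a t = c₀ + ∫ s in (0 : ℝ)..t, Complex.exp (l * s) * g s) :
    IsDuhamel t₀ T l c g a := by
  filter_upwards [ae_restrict_of_ae_restrict_of_subset (Set.Icc_subset_Icc_left ht₀.1) h,
    ae_restrict_mem measurableSet_Icc] with t ht htI
  have hi : ∀ r ∈ Set.Icc 0 T, IntervalIntegrable (fun s : ℝ => Complex.exp (l * s) * g s)
      volume 0 r := fun r hr => by
    rw [intervalIntegrable_iff_integrableOn_Icc_of_le hr.1]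
    exact hg.mono_set (Set.Icc_subset_Icc_right hr.2)
  have htI' : t ∈ Set.Icc 0 T := ⟨ht₀.1.trans htI.1, htI.2⟩
  have hsub := intervalIntegral.integral_interval_sub_left (hi t htI') (hi t₀ ht₀)
  have h1 : ∀ s : ℝ, Complex.exp (-l * (t - s)) * g s
      = Complex.exp (-(l * t)) * (Complex.exp (l * s) * g s) := fun s => by
    rw [← mul_assoc, ← Complex.exp_add]; ring_nf
  have h2 : Complex.exp (-l * (t - t₀)) * c
      = Complex.exp (-(l * t)) * (Complex.exp (l * t₀) * c) := by
    rw [← mul_assoc, ← Complex.exp_add]; ring_nf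
  simp_rw [h1]
  rw [h2, intervalIntegral.integral_const_mul, ← mul_add, ← hsub, h₀]
  rw [add_assoc, add_sub_cancel, ← ht, ← mul_assoc, ← Complex.exp_add]
  simp

/-! ### From the weak formulation to the system of modes. -/

/-- Time-dependent multiples of a character as test functions. -/
lemma isTestFunction_mul_fourier {T : ℝ} {η : ℝ → ℂ} (hη : ContDiff ℝ ∞ η)
    (hv : ∃ τ < T, ∀ t, τ ≤ t → η t = 0) (n : ℤ) :
    IsTestFunction T fun t x => η t * (fourier n x : ℂ) where
  smooth := (hη.comp contDiff_fst).mul (ContDiff.comp (g := fun y : ℝ => (fourier n (y : Torus) : ℂ))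
    (smoothOnTorus_fourier n) contDiff_snd)
  vanishes := by
    obtain ⟨τ, hτ, h⟩ := hv
    exact ⟨τ, hτ, fun t ht x => by simp [h t ht]⟩

namespace IsWeakSolution

variable {ν α γ T : ℝ} {u₀ : Torus → ℂ} {u : ℝ → Torus → ℂ}

lemma ae_memLp (hu : IsWeakSolution ν α γ T u₀ u) :
    ∀ᵐ t ∂(volume.restrict (Set.Icc 0 T)), MemLp (u t) 2 μT := by
  have h1 := hu.memLp.1.prodMk_left
  have h2 := (hu.memLp.integrable_norm_pow two_ne_zero).prod_right_ae
  filter_upwards [h1, h2] with t ht1 ht2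
  exact (memLp_two_iff_integrable_sq_norm ht1).2 ht2

lemma integrable_fourierCoeff_of_integrable {f : ℝ → Torus → ℂ} {S : Set ℝ}
    (hf : Integrable (Function.uncurry f) ((volume.restrict S).prod μT)) (n : ℤ) :
    IntegrableOn (fun t => fourierCoeff (f t) n) S := by
  have : Integrable (fun p : ℝ × Torus => (fourier (-n) p.2 : ℂ) • f p.1 p.2)
      ((volume.restrict S).prod μT) := by
    refine hf.bdd_smul 1 ?_ (ae_of_all _ fun p => (norm_fourier_apply _ _).le)
    exact ((map_continuous (fourier (-n))).comp continuous_snd).aestronglyMeasurable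
  exact this.integral_prod_left

lemma integrableOn_fourierCoeff (hu : IsWeakSolution ν α γ T u₀ u) (n : ℤ) :
    IntegrableOn (fun t => fourierCoeff (u t) n) (Set.Icc 0 T) :=
  integrable_fourierCoeff_of_integrable (hu.memLp.integrable (by norm_num)) n

lemma integrableOn_fourierCoeff_sq (hu : IsWeakSolution ν α γ T u₀ u) (n : ℤ) :
    IntegrableOn (fun t => fourierCoeff (fun x => u t x ^ 2) n) (Set.Icc 0 T) := by
  refine integrable_fourierCoeff_of_integrable (f := fun t x => u t x ^ 2) ?_ n
  have := hu.memLp.integrable_mul hu.memLp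
  refine this.congr (ae_of_all _ fun p => ?_)
  simp [Function.uncurry, sq]

/-- The weak formulation for one Fourier mode, with an integrating factor. -/
lemma weak_form_mode (hu : IsWeakSolution ν α γ T u₀ u) (n : ℤ) {θ : ℝ → ℝ}
    (hθ : ContDiff ℝ ∞ θ) (hv : ∃ τ < T, ∀ t, τ ≤ t → θ t = 0) :
    (∫ t in Set.Icc 0 T,
      (((deriv θ t : ℝ) : ℂ) * (Complex.exp (linearSymbol ν α γ n * t) * fourierCoeff (u t) n) +
        (θ t : ℂ) * (Complex.exp (linearSymbol ν α γ n * t) *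
          (3 * Complex.I * n * fourierCoeff (fun x => u t x ^ 2) n))))
      + θ 0 * fourierCoeff u₀ n = 0 := by
  set l := linearSymbol ν α γ n with hl
  -- With this factor the term `l η` of `η'` cancels the fractional Laplacian and the third
  -- derivative of the character, leaving only `θ'` and the quadratic term.
  set η : ℝ → ℂ := fun t : ℝ => Complex.exp (l * t) * θ t with hη
  have hηd : ∀ t : ℝ, HasDerivAt η
      (Complex.exp (l * t) * l * θ t + Complex.exp (l * t) * (deriv θ t : ℝ)) t := by
    intro t
    have h1 : HasDerivAt (fun t : ℝ => Complex.exp (l * t)) (Complex.exp (l * t) * l) t := by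
      have := ((hasDerivAt_id (t : ℂ)).const_mul l).cexp.comp_ofReal
      simpa using this
    exact h1.mul ((hθ.differentiable (by simp)) t).hasDerivAt.ofReal_comp
  have hηs : ContDiff ℝ ∞ η := by
    have h1 := Complex.ofRealCLM.contDiff (n := ∞)
    exact ((contDiff_const.mul h1).cexp).mul (h1.comp hθ)
  have hηv : ∃ τ < T, ∀ t, τ ≤ t → η t = 0 := by
    obtain ⟨τ, hτ, h⟩ := hv
    exact ⟨τ, hτ, fun t ht => by simp [hη, h t ht]⟩
  have key := hu.weak_form _ (isTestFunction_mul_fourier hηs hηv (-n))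
  have hinit : ∫ x, u₀ x * (η 0 * (fourier (-n) x : ℂ)) ∂μT = θ 0 * fourierCoeff u₀ n := by
    rw [fourierCoeff, ← integral_const_mul]
    congr 1; ext x
    simp [hη]; ring
  rw [hinit] at key
  rw [← key]
  congr 1
  refine integral_congr_ae ?_
  filter_upwards [hu.ae_memLp] with t ht
  have hi1 : Integrable (fun x => (fourier (-n) x : ℂ) • u t x) μT :=
    (ht.integrable (by norm_num)).fourier_smul _
  have hi2 : Integrable (fun x => (fourier (-n) x : ℂ) • u t x ^ 2) μT := by
    refine Integrable.fourier_smul ?_ _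
    refine (ht.integrable_mul ht).congr (ae_of_all _ fun x => ?_)
    simp [sq]
  have hderiv : ∀ x : Torus, deriv (fun s => η s * (fourier (-n) x : ℂ)) t
      = (Complex.exp (l * t) * l * θ t + Complex.exp (l * t) * (deriv θ t : ℝ)) *
        (fourier (-n) x : ℂ) := fun x => ((hηd t).mul_const _).deriv
  have hint : ∀ x : Torus,
      u t x * deriv (fun s => η s * (fourier (-n) x : ℂ)) t
          - 3 * u t x ^ 2 * torusDeriv 1 (fun x => η t * (fourier (-n) x : ℂ)) x
          - (ν : ℂ) * u t x * fracLaplacian γ (fun x => η t * (fourier (-n) x : ℂ)) x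
          + (α : ℂ) * u t x * torusDeriv 3 (fun x => η t * (fourier (-n) x : ℂ)) x
        = ((deriv θ t : ℝ) : ℂ) * Complex.exp (l * t) * ((fourier (-n) x : ℂ) • u t x) +
          (θ t : ℂ) * (Complex.exp (l * t) * (3 * Complex.I * n)) *
            ((fourier (-n) x : ℂ) • u t x ^ 2) := by
    intro x
    rw [hderiv, torusDeriv_const_mul_fourier, torusDeriv_const_mul_fourier,
      fracLaplacian_const_mul_fourier]
    have hI : Complex.I ^ 3 = -Complex.I := Complex.I_pow_three
    simp only [hη, hl, linearSymbol, smul_eq_mul]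
    push_cast
    rw [abs_neg, mul_pow Complex.I (-(n : ℂ)) 3, hI]
    ring
  simp_rw [hint]
  rw [integral_add (hi1.const_mul _) (hi2.const_mul _), integral_const_mul, integral_const_mul]
  simp only [fourierCoeff]
  ring

/-- Countably many modes share one null set; off it, the formula holds for all modes at once, as
restarting requires. -/
lemma ae_integrating_factor (hu : IsWeakSolution ν α γ T u₀ u) (hT : 0 < T) :
    ∀ᵐ t : ℝ ∂(volume.restrict (Set.Icc 0 T)), ∀ n,
      Complex.exp (linearSymbol ν α γ n * t) * fourierCoeff (u t) n
        = fourierCoeff u₀ n + ∫ s in (0 : ℝ)..t, Complex.exp (linearSymbol ν α γ n * s) *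
          (3 * Complex.I * n * fourierCoeff (fun x => u s x ^ 2) n) := by
  refine ae_all_iff.2 fun n => ?_
  have hc : ContinuousOn (fun t : ℝ => Complex.exp (linearSymbol ν α γ n * t)) (Set.Icc 0 T) := by
    fun_prop
  exact ae_eq_add_integral_of_weak hT
    ((hu.integrableOn_fourierCoeff n).continuousOn_mul hc isCompact_Icc)
    (IntegrableOn.continuousOn_mul hc ((hu.integrableOn_fourierCoeff_sq n).const_mul _)
      isCompact_Icc)
    fun θ hθ hv => hu.weak_form_mode n hθ hv

/-- Serves both starting points: time `0` with the coefficients of `u₀`, and almost every `t₀` with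
those of `u t₀`. -/
lemma isModalSolution_of_integrating_factor (hu : IsWeakSolution ν α γ T u₀ u) (hT : 0 < T)
    {t₀ : ℝ} (ht₀ : t₀ ∈ Set.Icc 0 T) {c : ℤ → ℂ}
    (h : ∀ n, Complex.exp (linearSymbol ν α γ n * t₀) * c n
        = fourierCoeff u₀ n + ∫ s in (0 : ℝ)..t₀, Complex.exp (linearSymbol ν α γ n * s) *
          (3 * Complex.I * n * fourierCoeff (fun x => u s x ^ 2) n)) :
    IsModalSolution ν α γ t₀ T c (fun t n => fourierCoeff (u t) n)
      (fun t n => fourierCoeff (fun x => u t x ^ 2) n) := by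
  have hsub : Set.Icc t₀ T ⊆ Set.Icc 0 T := Set.Icc_subset_Icc_left ht₀.1
  refine ⟨fun n => ((hu.integrableOn_fourierCoeff n).mono_set hsub).aemeasurable,
    fun n => ((hu.integrableOn_fourierCoeff_sq n).mono_set hsub).aemeasurable, ?_, fun n => ?_⟩
  · filter_upwards [ae_restrict_of_ae_restrict_of_subset hsub hu.ae_memLp] with t ht n
    exact enorm_fourierCoeff_sq_le_conv ht n
  · have hc : ContinuousOn (fun t : ℝ => Complex.exp (linearSymbol ν α γ n * t))
        (Set.Icc 0 T) := by
      fun_prop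
    refine isDuhamel_of_integrating_factor ht₀
      (IntegrableOn.continuousOn_mul hc ((hu.integrableOn_fourierCoeff_sq n).const_mul _)
      isCompact_Icc) (h n) ?_
    filter_upwards [hu.ae_integrating_factor hT] with t ht
    exact ht n

lemma isModalSolution_zero (hu : IsWeakSolution ν α γ T u₀ u) (hT : 0 < T) :
    IsModalSolution ν α γ 0 T (fourierCoeff u₀) (fun t n => fourierCoeff (u t) n)
      (fun t n => fourierCoeff (fun x => u t x ^ 2) n) :=
  hu.isModalSolution_of_integrating_factor hT ⟨le_rfl, hT.le⟩ fun n => by simp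

lemma ae_isModalSolution (hu : IsWeakSolution ν α γ T u₀ u) (hT : 0 < T) :
    ∀ᵐ t₀ ∂(volume.restrict (Set.Icc 0 T)),
      IsModalSolution ν α γ t₀ T (fourierCoeff (u t₀)) (fun t n => fourierCoeff (u t) n)
        (fun t n => fourierCoeff (fun x => u t x ^ 2) n) := by
  filter_upwards [hu.ae_integrating_factor hT, ae_restrict_mem measurableSet_Icc] with t₀ h ht₀
  exact hu.isModalSolution_of_integrating_factor hT ht₀ h

lemma isRegular_zero (hu : IsWeakSolution ν α γ T u₀ u) (hν : 0 < ν)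
    (hM₀ : baseEnergy ν γ 0 T u < ⊤) :
    IsRegular γ 0 T 0 fun t n => fourierCoeff (u t) n := by
  obtain ⟨h1, h2⟩ := ENNReal.add_lt_top.1 hM₀
  refine ⟨⟨_, h1, ?_⟩, ?_⟩
  · filter_upwards [ENNReal.ae_le_essSup (μ := volume.restrict (Set.Icc 0 T))
      (fun t => eLpNorm (u t) 2 μT ^ 2), hu.ae_memLp] with t ht hL
    rw [← tsum_enorm_fourierCoeff_sq hL] at ht
    simpa [weightedSum] using ht
  · have h3 := ENNReal.lt_top_of_mul_ne_top_right h2.ne (ENNReal.ofReal_pos.2 hν).ne'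
    simpa [dissipationSum, lambdaNormSq] using h3

end IsWeakSolution

/-! ### Return to the energies of the statement. -/

lemma lambdaNormSq_le_dissipationSum {γ : ℝ} (hγ : 0 ≤ γ) (k : ℕ) (f : Torus → ℂ) :
    lambdaNormSq (k + γ) f ≤ dissipationSum γ (2 * k) fun n => ‖fourierCoeff f n‖ₑ := by
  refine ENNReal.tsum_le_tsum fun n => ?_
  rw [← mul_assoc, mul_add, Real.rpow_add_of_nonneg (abs_nonneg _) (by positivity) (by positivity),
    ENNReal.ofReal_mul (by positivity)]
  gcongr
  have := ofReal_abs_pow_le_weight k n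
  rwa [← Real.rpow_natCast, Nat.cast_mul, Nat.cast_two] at this

lemma IsRegular.higherEnergy_lt_top {ν γ t₀ T : ℝ} {k : ℕ} {u : ℝ → Torus → ℂ} (hγ : 0 ≤ γ)
    (h : IsRegular γ t₀ T k fun t n => fourierCoeff (u t) n)
    (hL : ∀ᵐ t ∂(volume.restrict (Set.Icc t₀ T)), MemLp (u t) 2 μT) :
    higherEnergy ν γ t₀ T k u < ⊤ := by
  obtain ⟨C, hC, hb⟩ := h.bounded
  refine ENNReal.add_lt_top.2 ⟨lt_of_le_of_lt (essSup_le_of_ae_le C ?_) hC,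
    ENNReal.mul_lt_top ENNReal.ofReal_lt_top
      ((lintegral_mono fun t => lambdaNormSq_le_dissipationSum hγ k (u t)).trans_lt
        h.dissipation)⟩
  filter_upwards [hb, hL] with t h1 h2
  exact (derivNormSq_le_weightedSum k h2).trans h1

end FracKdVB

theorem theorem2p6 (ν α γ T : ℝ) (hν : 0 < ν) (hγ : 1 ≤ γ) (hT : 0 < T)
    (u₀ : FracKdVB.Torus → ℂ) (u : ℝ → FracKdVB.Torus → ℂ)
    (hu : FracKdVB.IsWeakSolution ν α γ T u₀ u)
    (hM₀ : FracKdVB.baseEnergy ν γ 0 T u < ⊤) :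
    ∀ k : ℕ, 0 < k →
      (FracKdVB.derivNormSq k u₀ < ⊤ → FracKdVB.higherEnergy ν γ 0 T k u < ⊤) ∧
      (∀ δ : ℝ, 0 < δ → δ < T → FracKdVB.higherEnergy ν γ δ T k u < ⊤) := by
  intro k _
  have h0 := hu.isRegular_zero hν hM₀
  have hγ0 : 0 ≤ γ := zero_le_one.trans hγ
  -- `k` derivatives are `4 * k` gains of a quarter.
  have hk : (((4 * k : ℕ) : ℝ) / 4) = k := by push_cast; ring
  refine ⟨fun hk₀ => ?_, fun δ hδ hδT => ?_⟩
  · have hreg := (hu.isModalSolution_zero hT).isRegular_of_initial hν hγ h0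
      (FracKdVB.weightedSum_lt_top_of_derivNormSq hu.memLp_initial hk₀) (4 * k) hk.le
    rw [hk] at hreg
    exact hreg.higherEnergy_lt_top hγ0 hu.ae_memLp
  · have hreg := FracKdVB.isRegular_of_restart hν hγ h0
      (fun n => (hu.integrableOn_fourierCoeff n).aemeasurable) (hu.ae_isModalSolution hT)
      (4 * k) δ hδ hδT
    rw [hk] at hreg
    exact hreg.higherEnergy_lt_top hγ0
      (ae_restrict_of_ae_restrict_of_subset (Set.Icc_subset_Icc_left hδ.le) hu.ae_memLp)
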